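/- Let $\mathcal H=\mathbb C^d$ with incoherent orthonormal basis $|0\rangle,\dots,|d-1\rangle$. A unit vector is \emph{incoherent} if it equals some $|k\rangle$ up to a phase, and \emph{coherent} otherwise; its geometric coherence is $c(|\psi\rangle)=1-\max_k|\langle k|\psi\rangle|^2$. An unknown unitary $U_\psi$ on $\mathcal H$ prepares $|\psi\rangle=U_\psi|0\rangle$. A \emph{protocol} acts on $\mathcal H$ and a finite-dimensional workspace, initially in $|0\rangle|0\rangle$. It interleaves calls to the black box $U\in\{U_\psi,U_\psi^\dagger\}$ with processing that does not depend on $U_\psi$ (unitaries, measurements, classical randomness, adaptively chosen from earlier outcomes), and it may stop at a random time with the verdict "coherent" or "incoherent", or run forever. Its cost on $U_\psi$ is the expected total number of calls to $U_\psi$ and $U_\psi^\dagger$. Detecting coherence with error probability $\delta<\tfrac12$ takes $\Theta\bigl(c^{-1/2}\log\delta^{-1}\bigr)$ calls on average, in the following two senses. (A) Fixed $\delta$, every coherent state individually. (A1) There is a universal constant $K>0$ such that for all $d$ and all $0<\delta<\frac12$ some protocol (independent of $U_\psi$ and of $c(|\psi\rangle)$) never says "coherent" when $|\psi\rangle$ is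 incoherent and, for every coherent $|\psi\rangle$, says "coherent" with probability at least $1-\delta$ and makes on average at most $K\,c(|\psi\rangle)^{-1/2}\log\delta^{-1}$ calls. (A2) For every $0<\delta<\frac12$ there is $K_\delta>0$ such that for every $d$, every protocol that says "coherent" with probability at most $\delta$ on every $U_\psi$ with $|\psi\rangle$ incoherent, and every $U_\psi$ with $|\psi\rangle$ coherent on which it says "coherent" with probability at least $1-\delta$, the protocol makes on average at least $K_\delta\,c(|\psi\rangle)^{-1/2}\log\delta^{-1}$ calls on $U_\psi$. (B) Unknown state, uniformly in $\delta$. Say that a protocol tests coherence at threshold $\varepsilon$ with error $\delta$ if it says "incoherent" with probability at least $1-\delta$ whenever $|\psi\rangle$ is incoherent, and "coherent" with probability at least $1-\delta$ whenever $c(|\psi\rangle)\ge\varepsilon$. (B1) There is a universal constant $K>0$ such that for all $d$, $0<\delta<\frac12$ and $\varepsilon>0$ some protocol tests coherence at threshold $\varepsilon$ with error $\delta$ and makes on average at most $K\varepsilon^{-1/2}\log\delta^{-1}$ calls on every $U_\psi$. (B2) For all $\delta_0<\frac12$ and $\tau<1$ there is $K>0$ such that for all $d$, all $0<\delta\le\delta_0$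 and all $0<\varepsilon\le\tau(1-\frac1d)$ (where $1-\frac1d$ is the largest possible value of $c$), every protocol that tests coherence at threshold $\varepsilon$ with error $\delta$ makes on average at least $K\varepsilon^{-1/2}\log\delta^{-1}$ calls on some $U_\psi$ with $|\psi\rangle$ incoherent or $c(|\psi\rangle)\ge\varepsilon$. -/

import Mathlib

open scoped ENNReal Kronecker Matrix

/-- The incoherent basis vector `|k⟩`. -/
def basisVec {d : ℕ} (k : Fin d) : Fin d → ℂ := Pi.single k 1

/-- The state `|ψ⟩ = U |0⟩` prepared by the unitary `U`. -/
def preparedState {d : ℕ} [NeZero d] (U : Matrix.unitaryGroup (Fin d) ℂ) : Fin d → ℂ :=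
  (U : Matrix (Fin d) (Fin d) ℂ) *ᵥ basisVec 0

/-- A state vector is incoherent when it is an incoherent basis vector up to a global phase. -/
def IsIncoherent {d : ℕ} (ψ : Fin d → ℂ) : Prop :=
  ∃ (k : Fin d) (z : ℂ), ‖z‖ = 1 ∧ ψ = z • basisVec k

/-- The geometric measure of coherence `c(ψ) = 1 - max_k |⟨k|ψ⟩|²`. -/
noncomputable def geometricCoherence {d : ℕ} (ψ : Fin d → ℂ) : ℝ :=
  1 - ⨆ k : Fin d, ‖star (basisVec k) ⬝ᵥ ψ‖ ^ 2

/-- The two answers a detection protocol can give. -/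
inductive Verdict
  | coherent
  | incoherent
  deriving DecidableEq

/-- One step of a protocol acting on a register with basis `ι`, whose classical memory
takes values in `Mem`:
* `halt`: stop and announce a verdict;
* `query inverse next`: one call to the black box `U` (or to its inverse `U†`);
* `process n K _ next`: any input-independent processing, given by Kraus operators `K o` labelled
  by the observed outcome `o`. Unitary gates (`n = 1`), classical randomness (`K o = √(p o) • 1`),
  projective measurements and POVMs, and resets are all of this form. -/
inductive Step (ι : Type) [Fintype ι] [DecidableEq ι] (Mem : Type) : Type
  | halt (verdict : Verdict)
  | query (inverse : Bool) (next : Mem)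
  | process (n : ℕ) (K : Fin n → Matrix ι ι ℂ) (complete : ∑ o, (K o)ᴴ * K o = 1)
      (next : Fin n → Mem)

/-- An adaptive protocol with black-box access to an unknown `d`-dimensional unitary and its
inverse. It has a workspace of arbitrary finite dimension `work + 1` next to the `d`-dimensional
system, and an arbitrary classical memory, which selects the next step. In particular it may
perform the circuit `V_m U V_{m-1} ⋯ U V_0` followed by a two-outcome measurement; it may also
measure in between, repeat, and stop after a random number of queries, or never. -/
structure Protocol (d : ℕ) where
  work : ℕ
  Mem : Type
  start : Mem
  action : Mem → Step (Fin d × Fin (work + 1)) Mem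

/-- The squared norm of a vector; for an unnormalized branch state it is the probability of
the branch. -/
noncomputable def weight {ι : Type} [Fintype ι] (v : ι → ℂ) : ℝ≥0∞ := ∑ i, ‖v i‖ₑ ^ 2

/-- The black box acting on system and workspace: `U ⊗ 1`, or `U† ⊗ 1` for an inverse query. -/
def oracle {d w : ℕ} (U : Matrix.unitaryGroup (Fin d) ℂ) (inverse : Bool) :
    Matrix (Fin d × Fin w) (Fin d × Fin w) ℂ :=
  (if inverse then (U : Matrix (Fin d) (Fin d) ℂ)ᴴ else (U : Matrix (Fin d) (Fin d) ℂ)) ⊗ₖ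
    (1 : Matrix (Fin w) (Fin w) ℂ)

namespace Protocol

variable {d : ℕ}

/-- Started with memory `s` and (unnormalized) register state `v`, the probability that the
protocol announces the verdict `b` within its first `n` steps. -/
noncomputable def verdictProbIn (P : Protocol d) (U : Matrix.unitaryGroup (Fin d) ℂ)
    (b : Verdict) : ℕ → P.Mem → (Fin d × Fin (P.work + 1) → ℂ) → ℝ≥0∞
  | 0, _, _ => 0
  | n + 1, s, v =>
    match P.action s with
    | .halt b' => if b' = b then weight v else 0
    | .query inverse s' => P.verdictProbIn U b n s' (oracle U inverse *ᵥ v)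
    | .process _ K _ next => ∑ o, P.verdictProbIn U b n (next o) (K o *ᵥ v)

/-- Started with memory `s` and (unnormalized) register state `v`, the expected number of
queries made in the first `n` steps. -/
noncomputable def expectedQueriesIn (P : Protocol d) (U : Matrix.unitaryGroup (Fin d) ℂ) :
    ℕ → P.Mem → (Fin d × Fin (P.work + 1) → ℂ) → ℝ≥0∞
  | 0, _, _ => 0
  | n + 1, s, v =>
    match P.action s with
    | .halt _ => 0
    | .query inverse s' => weight v + P.expectedQueriesIn U n s' (oracle U inverse *ᵥ v)
    | .process _ K _ next => ∑ o, P.expectedQueriesIn U n (next o) (K o *ᵥ v)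

/-- The initial register state `|0⟩ ⊗ |0⟩`. -/
def initial [NeZero d] (P : Protocol d) : Fin d × Fin (P.work + 1) → ℂ := Pi.single (0, 0) 1

/-- The probability that the protocol, run on the black box `U`, ever announces `b`. -/
noncomputable def verdictProb [NeZero d] (P : Protocol d) (U : Matrix.unitaryGroup (Fin d) ℂ)
    (b : Verdict) : ℝ≥0∞ :=
  ⨆ n, P.verdictProbIn U b n P.start P.initial

/-- The expected total number of queries (calls to `U` and to `U†` together) that the protocol
makes when it is run on the black box `U`. -/
noncomputable def expectedQueries [NeZero d] (P : Protocol d)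
    (U : Matrix.unitaryGroup (Fin d) ℂ) : ℝ≥0∞ :=
  ⨆ n, P.expectedQueriesIn U n P.start P.initial

/-- The protocol tests the hypothesis "`ψ` is incoherent" against "`c(ψ) ≥ ε`" for the unknown
state `ψ = U|0⟩` with error probability at most `δ` under either hypothesis. -/
def TestsCoherence [NeZero d] (P : Protocol d) (ε δ : ℝ) : Prop :=
  (∀ U, IsIncoherent (preparedState U) →
    ENNReal.ofReal (1 - δ) ≤ P.verdictProb U .incoherent) ∧
  (∀ U, ε ≤ geometricCoherence (preparedState U) →
    ENNReal.ofReal (1 - δ) ≤ P.verdictProb U .coherent)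

end Protocol

/-! Upper bounds. One measurement of ψ gives an outcome k. With cos θ = |ψ k|, t Grover iterations
followed by a readout return k again with probability cos²((2t+1)θ), at a cost of 2t+1 queries. For
incoherent ψ the angle is 0, so a different outcome is a proof of coherence. In general sin²θ ≥ c,
and some j satisfies π/6 ≤ 3^j θ ≤ π/2 and 3^j √c ≤ 2 (`exists_miss_le`), so O(log δ⁻¹) repetitions
of an attempt with 3^j queries all miss with probability at most δ. When c is unknown, stage J runs
the attempts 0, …, J. Past the right j a stage fails with probability at most 1/4 while the next one
costs three times as much, so the expected cost is a convergent geometric series. For a known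
threshold ε a single stage suffices.

Lower bound for one state. A unitary preparing a state of coherence c is within 4√c of one preparing
an incoherent state (`exists_incoherent_norm_sub_le`). By the hybrid argument
(`sqrt_truncatedProb_le_add`), N queries change the square root of a verdict probability by at most
4N√c, so separating 1/2 from δ needs N of order c^(-1/2). Markov's inequality
(`verdictProbIn_le_truncatedProb_add`) reduces random stopping to a fixed query budget.

Lower bound uniform in δ. The factor log δ⁻¹ comes from the polynomial method. For the unitaries
that multiply a fixed vector by a phase z, the probability of "incoherent" within N queries, summed
over z and its conjugate, is a polynomial of degree at most N in Re z
(`exists_truncatedProb_add_eq_eval`). It is at most 2δ on an interval where the prepared state has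
coherence at least ε, and at least 1 at Re z = 1, where the unitary is the identity. That point lies
only 2ε beyond the interval, and Chebyshev's growth bound (`Polynomial.eval_le_mul_exp`) gives 1 ≤
2δ exp(O(N√ε)). -/

/-! ### Squared norms and Kraus operators -/

section SquaredNorm

variable {ι : Type} [Fintype ι]

/-- The real-valued squared Euclidean norm of a vector. -/
noncomputable def sqNorm (v : ι → ℂ) : ℝ := ∑ i, ‖v i‖ ^ 2

theorem sqNorm_nonneg (v : ι → ℂ) : 0 ≤ sqNorm v :=
  Finset.sum_nonneg fun _ _ => by positivity

theorem weight_eq_ofReal (v : ι → ℂ) : weight v = ENNReal.ofReal (sqNorm v) := by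
  unfold weight sqNorm
  rw [ENNReal.ofReal_sum_of_nonneg fun _ _ => by positivity]
  refine Finset.sum_congr rfl fun i _ => ?_
  rw [← ofReal_norm, ENNReal.ofReal_pow (norm_nonneg _)]

theorem sqNorm_eq_norm_sq (v : ι → ℂ) : sqNorm v = ‖WithLp.toLp 2 v‖ ^ 2 := by
  rw [EuclideanSpace.norm_sq_eq]; rfl

theorem sqNorm_eq_dotProduct (v : ι → ℂ) : (sqNorm v : ℂ) = star v ⬝ᵥ v := by
  simp only [sqNorm, dotProduct, Complex.ofReal_sum, Pi.star_apply]
  refine Finset.sum_congr rfl fun i _ => ?_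
  rw [Complex.ofReal_pow, ← Complex.conj_mul']; rfl

theorem sqNorm_smul (c : ℂ) (v : ι → ℂ) : sqNorm (c • v) = ‖c‖ ^ 2 * sqNorm v := by
  simp [sqNorm, Finset.mul_sum, mul_pow]

theorem weight_smul (c : ℂ) (v : ι → ℂ) : weight (c • v) = ‖c‖ₑ ^ 2 * weight v := by
  simp [weight, Finset.mul_sum, mul_pow]

theorem sqrt_sqNorm_add_le (v w : ι → ℂ) : √(sqNorm (v + w)) ≤ √(sqNorm v) + √(sqNorm w) := by
  simp only [sqNorm_eq_norm_sq, Real.sqrt_sq (norm_nonneg _), WithLp.toLp_add]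
  exact norm_add_le _ _

theorem sqNorm_single [DecidableEq ι] (i : ι) : sqNorm (Pi.single i (1 : ℂ)) = 1 := by
  rw [sqNorm, Finset.sum_eq_single i] <;> simp +contextual

theorem star_mulVec_dotProduct (A : Matrix ι ι ℂ) (v : ι → ℂ) :
    star (A *ᵥ v) ⬝ᵥ (A *ᵥ v) = star v ⬝ᵥ ((Aᴴ * A) *ᵥ v) := by
  rw [Matrix.star_mulVec, ← Matrix.dotProduct_mulVec, Matrix.mulVec_mulVec]

variable [DecidableEq ι]

/-- Completeness turns the sum of the quadratic forms of (K o)ᴴ K o into that of the identity.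
Branch weights therefore behave as a probability distribution. -/
theorem sum_sqNorm_mulVec {n : ℕ} (K : Fin n → Matrix ι ι ℂ) (hK : ∑ o, (K o)ᴴ * K o = 1)
    (v : ι → ℂ) : ∑ o, sqNorm (K o *ᵥ v) = sqNorm v := by
  have : ((∑ o, sqNorm (K o *ᵥ v) : ℝ) : ℂ) = sqNorm v := by
    simp only [Complex.ofReal_sum, sqNorm_eq_dotProduct, star_mulVec_dotProduct]
    rw [← dotProduct_sum, ← Matrix.sum_mulVec, hK, Matrix.one_mulVec]
  exact_mod_cast this

theorem sum_weight_mulVec {n : ℕ} (K : Fin n → Matrix ι ι ℂ) (hK : ∑ o, (K o)ᴴ * K o = 1)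
    (v : ι → ℂ) : ∑ o, weight (K o *ᵥ v) = weight v := by
  simp only [weight_eq_ofReal]
  rw [← ENNReal.ofReal_sum_of_nonneg fun _ _ => sqNorm_nonneg _, sum_sqNorm_mulVec K hK]

theorem sqNorm_mulVec_of_conjTranspose_mul_self (A : Matrix ι ι ℂ) (hA : Aᴴ * A = 1)
    (v : ι → ℂ) : sqNorm (A *ᵥ v) = sqNorm v := by
  have := sum_sqNorm_mulVec (fun _ : Fin 1 => A) (by simpa using hA) v
  simpa using this

/-- Minkowski's inequality for square roots of sums. -/
theorem sqrt_sum_le {κ : Type*} (s : Finset κ) {f a b : κ → ℝ} {c : ℝ} (hc : 0 ≤ c)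
    (hf : ∀ i, 0 ≤ f i) (ha : ∀ i, 0 ≤ a i) (hb : ∀ i, 0 ≤ b i)
    (h : ∀ i, √(f i) ≤ √(a i) + c * √(b i)) :
    √(∑ i ∈ s, f i) ≤ √(∑ i ∈ s, a i) + c * √(∑ i ∈ s, b i) := by
  have h1 := Real.Lp_add_le_of_nonneg s (p := 2) (by norm_num)
    (f := fun i => √(a i)) (g := fun i => c * √(b i)) (fun i _ => Real.sqrt_nonneg _)
    (fun i _ => mul_nonneg hc (Real.sqrt_nonneg _))
  simp only [← Real.sqrt_eq_rpow, Real.rpow_two, Real.sq_sqrt (ha _), mul_pow,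
    Real.sq_sqrt (hb _), ← Finset.mul_sum] at h1
  rw [Real.sqrt_mul (sq_nonneg c), Real.sqrt_sq hc] at h1
  refine le_trans (Real.sqrt_le_sqrt (Finset.sum_le_sum fun i _ => ?_)) h1
  have := pow_le_pow_left₀ (Real.sqrt_nonneg _) (h i) 2
  rwa [Real.sq_sqrt (hf i)] at this

end SquaredNorm

/-! ### Queries preserve the norm -/

section Oracle

variable {d w : ℕ}

theorem oracle_conjTranspose_mul_self (U : Matrix.unitaryGroup (Fin d) ℂ) (inverse : Bool) :
    (oracle (w := w) U inverse)ᴴ * oracle U inverse = 1 := by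
  have h1 : (U : Matrix (Fin d) (Fin d) ℂ)ᴴ * (U : Matrix (Fin d) (Fin d) ℂ) = 1 :=
    Matrix.UnitaryGroup.star_mul_self U
  have h2 : (U : Matrix (Fin d) (Fin d) ℂ) * (U : Matrix (Fin d) (Fin d) ℂ)ᴴ = 1 :=
    (Matrix.mem_unitaryGroup_iff).1 U.2
  cases inverse <;>
    simp [oracle, Matrix.conjTranspose_kronecker, ← Matrix.mul_kronecker_mul, h1, h2]

theorem sqNorm_oracle_mulVec (U : Matrix.unitaryGroup (Fin d) ℂ) (inverse : Bool)
    (v : Fin d × Fin w → ℂ) : sqNorm (oracle U inverse *ᵥ v) = sqNorm v :=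
  sqNorm_mulVec_of_conjTranspose_mul_self _ (oracle_conjTranspose_mul_self U inverse) v

theorem weight_oracle_mulVec (U : Matrix.unitaryGroup (Fin d) ℂ) (inverse : Bool)
    (v : Fin d × Fin w → ℂ) : weight (oracle U inverse *ᵥ v) = weight v := by
  rw [weight_eq_ofReal, weight_eq_ofReal, sqNorm_oracle_mulVec]

end Oracle

/-! ### Homogeneity, monotonicity and total probability of runs -/

namespace Protocol

variable {d : ℕ} (P : Protocol d) (U : Matrix.unitaryGroup (Fin d) ℂ)

theorem verdictProbIn_smul (b : Verdict) (c : ℂ) (n : ℕ) (s : P.Mem)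
    (v : Fin d × Fin (P.work + 1) → ℂ) :
    P.verdictProbIn U b n s (c • v) = ‖c‖ₑ ^ 2 * P.verdictProbIn U b n s v := by
  induction n generalizing s v with
  | zero => simp [verdictProbIn]
  | succ n ih =>
    simp only [verdictProbIn]
    cases P.action s with
    | halt b' => simp only [weight_smul]; split <;> simp
    | query inv s' => simp only [Matrix.mulVec_smul, ih]
    | process m K hK next => simp only [Matrix.mulVec_smul, ih, Finset.mul_sum]

theorem expectedQueriesIn_smul (c : ℂ) (n : ℕ) (s : P.Mem)
    (v : Fin d × Fin (P.work + 1) → ℂ) :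
    P.expectedQueriesIn U n s (c • v) = ‖c‖ₑ ^ 2 * P.expectedQueriesIn U n s v := by
  induction n generalizing s v with
  | zero => simp [expectedQueriesIn]
  | succ n ih =>
    simp only [expectedQueriesIn]
    cases P.action s with
    | halt b' => simp
    | query inv s' => simp only [Matrix.mulVec_smul, ih, weight_smul, mul_add]
    | process m K hK next => simp only [Matrix.mulVec_smul, ih, Finset.mul_sum]

theorem verdictProbIn_le_succ (b : Verdict) (n : ℕ) (s : P.Mem)
    (v : Fin d × Fin (P.work + 1) → ℂ) :
    P.verdictProbIn U b n s v ≤ P.verdictProbIn U b (n + 1) s v := by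
  induction n generalizing s v with
  | zero => simp [verdictProbIn]
  | succ n ih =>
    rw [verdictProbIn, verdictProbIn]
    cases P.action s with
    | halt b' => exact le_rfl
    | query inv s' => exact ih _ _
    | process m K hK next => exact Finset.sum_le_sum fun o _ => ih _ _

theorem expectedQueriesIn_le_succ (n : ℕ) (s : P.Mem) (v : Fin d × Fin (P.work + 1) → ℂ) :
    P.expectedQueriesIn U n s v ≤ P.expectedQueriesIn U (n + 1) s v := by
  induction n generalizing s v with
  | zero => simp [expectedQueriesIn]
  | succ n ih =>
    rw [expectedQueriesIn, expectedQueriesIn]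
    cases P.action s with
    | halt b' => exact le_rfl
    | query inv s' => exact add_le_add le_rfl (ih _ _)
    | process m K hK next => exact Finset.sum_le_sum fun o _ => ih _ _

theorem verdictProbIn_monotone (b : Verdict) (s : P.Mem) (v : Fin d × Fin (P.work + 1) → ℂ) :
    Monotone fun n => P.verdictProbIn U b n s v :=
  monotone_nat_of_le_succ fun n => P.verdictProbIn_le_succ U b n s v

/-- Queries and complete Kraus families conserve weight, and a halting branch gives its weight to
one verdict only. A reliable verdict thus forces the opposite one to be rare. -/
theorem verdictProbIn_add_le (n : ℕ) (s : P.Mem) (v : Fin d × Fin (P.work + 1) → ℂ) :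
    P.verdictProbIn U .coherent n s v + P.verdictProbIn U .incoherent n s v ≤ weight v := by
  induction n generalizing s v with
  | zero => simp [verdictProbIn]
  | succ n ih =>
    simp only [verdictProbIn]
    cases P.action s with
    | halt b' => cases b' <;> simp
    | query inv s' => simpa [weight_oracle_mulVec] using ih s' (oracle U inv *ᵥ v)
    | process m K hK next =>
      simp only
      rw [← Finset.sum_add_distrib, ← sum_weight_mulVec K hK v]
      exact Finset.sum_le_sum fun o _ => ih _ _

theorem verdictProbIn_le_weight (b : Verdict) (n : ℕ) (s : P.Mem)
    (v : Fin d × Fin (P.work + 1) → ℂ) : P.verdictProbIn U b n s v ≤ weight v := by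
  cases b
  · exact le_self_add.trans (P.verdictProbIn_add_le U n s v)
  · exact le_add_self.trans (P.verdictProbIn_add_le U n s v)

variable [NeZero d]

theorem weight_initial : weight P.initial = 1 := by
  rw [weight_eq_ofReal, initial, sqNorm_single, ENNReal.ofReal_one]

theorem sqNorm_initial : sqNorm P.initial = 1 := sqNorm_single _

theorem verdictProb_add_le :
    P.verdictProb U .coherent + P.verdictProb U .incoherent ≤ 1 := by
  rw [verdictProb, verdictProb, ENNReal.iSup_add_iSup_of_monotone
    (P.verdictProbIn_monotone U _ _ _) (P.verdictProbIn_monotone U _ _ _)]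
  exact iSup_le fun n => (P.verdictProbIn_add_le U n _ _).trans P.weight_initial.le

end Protocol

/-! ### Truncation to a query budget -/

namespace Protocol

variable {d : ℕ}

/-- The probability of the verdict `b` within `n` steps and `k` queries, for a protocol whose
queries are answered by the matrices `O`. -/
noncomputable def truncatedProb (P : Protocol d)
    (O : Bool → Matrix (Fin d × Fin (P.work + 1)) (Fin d × Fin (P.work + 1)) ℂ) (b : Verdict) :
    ℕ → ℕ → P.Mem → (Fin d × Fin (P.work + 1) → ℂ) → ℝ
  | 0, _, _, _ => 0
  | n + 1, k, s, v =>
    match P.action s with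
    | .halt b' => if b' = b then sqNorm v else 0
    | .query inverse s' =>
      match k with
      | 0 => 0
      | k + 1 => P.truncatedProb O b n k s' (O inverse *ᵥ v)
    | .process _ K _ next => ∑ o, P.truncatedProb O b n k (next o) (K o *ᵥ v)

variable (P : Protocol d)

theorem truncatedProb_nonneg
    (O : Bool → Matrix (Fin d × Fin (P.work + 1)) (Fin d × Fin (P.work + 1)) ℂ) (b : Verdict)
    (n k : ℕ) (s : P.Mem) (v : Fin d × Fin (P.work + 1) → ℂ) :
    0 ≤ P.truncatedProb O b n k s v := by
  induction n generalizing k s v with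
  | zero => simp [truncatedProb]
  | succ n ih =>
    rw [truncatedProb]
    cases P.action s with
    | halt b' => simp only; split
                 · exact sqNorm_nonneg v
                 · exact le_rfl
    | query inv s' => cases k with
      | zero => exact le_rfl
      | succ k => exact ih _ _ _
    | process m K hK next => exact Finset.sum_nonneg fun o _ => ih _ _ _

theorem ofReal_truncatedProb_le (U : Matrix.unitaryGroup (Fin d) ℂ) (b : Verdict)
    (n k : ℕ) (s : P.Mem) (v : Fin d × Fin (P.work + 1) → ℂ) :
    ENNReal.ofReal (P.truncatedProb (oracle U) b n k s v) ≤ P.verdictProbIn U b n s v := by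
  induction n generalizing k s v with
  | zero => simp [truncatedProb]
  | succ n ih =>
    rw [truncatedProb, verdictProbIn]
    cases P.action s with
    | halt b' => simp only; split <;> simp [weight_eq_ofReal]
    | query inv s' => cases k with
      | zero => simp
      | succ k => exact ih _ _ _
    | process m K hK next =>
      simp only
      rw [ENNReal.ofReal_sum_of_nonneg fun _ _ => P.truncatedProb_nonneg _ _ _ _ _ _]
      exact Finset.sum_le_sum fun o _ => ih _ _ _

/-- Markov's inequality for the number of queries. -/
theorem verdictProbIn_le_truncatedProb_add (U : Matrix.unitaryGroup (Fin d) ℂ) (b : Verdict)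
    (n k : ℕ) (s : P.Mem) (v : Fin d × Fin (P.work + 1) → ℂ) :
    (k + 1) * P.verdictProbIn U b n s v ≤
      (k + 1) * ENNReal.ofReal (P.truncatedProb (oracle U) b n k s v) +
        P.expectedQueriesIn U n s v := by
  induction n generalizing k s v with
  | zero => simp [verdictProbIn]
  | succ n ih =>
    rw [truncatedProb, verdictProbIn, expectedQueriesIn]
    cases P.action s with
    | halt b' => simp only; split <;> simp [weight_eq_ofReal]
    | query inv s' =>
      -- A query lowers the budget by one. The copy of the verdict probability lost in this way is
      -- paid for by the weight that the query adds to the expected count.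
      have hw := P.verdictProbIn_le_weight U b n s' (oracle U inv *ᵥ v)
      rw [weight_oracle_mulVec] at hw
      cases k with
      | zero => simpa using hw.trans le_self_add
      | succ k =>
        have := add_le_add (ih k s' (oracle U inv *ᵥ v)) hw
        simp only [Nat.cast_add, Nat.cast_one]
        calc (k + 1 + 1) * P.verdictProbIn U b n s' (oracle U inv *ᵥ v)
            = (k + 1) * P.verdictProbIn U b n s' (oracle U inv *ᵥ v) +
              P.verdictProbIn U b n s' (oracle U inv *ᵥ v) := by ring
          _ ≤ _ := this
          _ = (k + 1) * ENNReal.ofReal (P.truncatedProb (oracle U) b n k s'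
                (oracle U inv *ᵥ v)) +
              (weight v + P.expectedQueriesIn U n s' (oracle U inv *ᵥ v)) := by ring
          _ ≤ _ := by gcongr; exact le_self_add
    | process m K hK next =>
      simp only
      rw [ENNReal.ofReal_sum_of_nonneg fun _ _ => P.truncatedProb_nonneg _ _ _ _ _ _,
        Finset.mul_sum, Finset.mul_sum, ← Finset.sum_add_distrib]
      exact Finset.sum_le_sum fun o _ => ih _ _ _

/-- A verdict that is reached with probability more than `p` is reached with probability at least
`p - η` within `N` queries, when the expected number of queries is at most `η * (N + 1)`. -/
theorem exists_le_truncatedProb [NeZero d] (U : Matrix.unitaryGroup (Fin d) ℂ) (b : Verdict)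
    {p η : ℝ} (N : ℕ) (hp : ENNReal.ofReal p < P.verdictProb U b) (hη : 0 ≤ η)
    (hN : P.expectedQueries U ≤ ENNReal.ofReal (η * (N + 1))) :
    ∃ n, p - η ≤ P.truncatedProb (oracle U) b n N P.start P.initial := by
  -- Strictness of `hp` provides a finite horizon at which the probability already exceeds p.
  obtain ⟨n, hn⟩ := lt_iSup_iff.1 hp
  refine ⟨n, ?_⟩
  set g := P.truncatedProb (oracle U) b n N P.start P.initial with hg
  have hg0 : 0 ≤ g := P.truncatedProb_nonneg _ _ _ _ _ _
  have h1 := P.verdictProbIn_le_truncatedProb_add U b n N P.start P.initial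
  have h2 : P.expectedQueriesIn U n P.start P.initial ≤ ENNReal.ofReal (η * (N + 1)) :=
    (le_iSup (fun n => P.expectedQueriesIn U n P.start P.initial) n).trans hN
  have h3 : ENNReal.ofReal ((N + 1) * p) ≤ ENNReal.ofReal ((N + 1) * g + η * (N + 1)) := by
    rw [ENNReal.ofReal_mul (by positivity : (0 : ℝ) ≤ N + 1),
      ENNReal.ofReal_add (by positivity : 0 ≤ (N + 1) * g) (by positivity),
      ENNReal.ofReal_mul (by positivity : (0 : ℝ) ≤ N + 1)]
    have : ENNReal.ofReal ((N : ℝ) + 1) = N + 1 := by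
      rw [ENNReal.ofReal_add (by positivity) zero_le_one]; simp
    rw [this]
    calc _ ≤ _ := by gcongr
      _ ≤ _ := h1
      _ ≤ _ := by gcongr
  have h4 := (ENNReal.ofReal_le_ofReal_iff (by positivity)).1 h3
  have : (0 : ℝ) < N + 1 := by positivity
  nlinarith

end Protocol

/-! ### Phase rotations, reflections and operator norms -/

section PhaseRotation

variable {ι : Type} [DecidableEq ι]

/-- The operator that multiplies the unit vector `x` by `z` and fixes its orthogonal complement. -/
def phaseRotation (x : ι → ℂ) (z : ℂ) : Matrix ι ι ℂ :=
  1 - (1 - z) • Matrix.vecMulVec x (star x)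

theorem phaseRotation_one (x : ι → ℂ) : phaseRotation x 1 = 1 := by simp [phaseRotation]

theorem phaseRotation_conjTranspose (x : ι → ℂ) (z : ℂ) :
    (phaseRotation x z)ᴴ = phaseRotation x (star z) := by
  simp [phaseRotation, Matrix.conjTranspose_sub, Matrix.conjTranspose_smul,
    Matrix.conjTranspose_vecMulVec]

variable [Fintype ι]

theorem phaseRotation_mulVec (x : ι → ℂ) (z : ℂ) (v : ι → ℂ) :
    phaseRotation x z *ᵥ v = v - ((1 - z) * (star x ⬝ᵥ v)) • x := by
  simp [phaseRotation, Matrix.sub_mulVec, Matrix.smul_mulVec, Matrix.vecMulVec_mulVec, smul_smul]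

theorem phaseRotation_mul {x : ι → ℂ} (hx : star x ⬝ᵥ x = 1) (z w : ℂ) :
    phaseRotation x z * phaseRotation x w = phaseRotation x (z * w) := by
  have : Matrix.vecMulVec x (star x) * Matrix.vecMulVec x (star x) =
      Matrix.vecMulVec x (star x) := by
    rw [Matrix.vecMulVec_mul_vecMulVec, hx, one_smul]
  simp only [phaseRotation, mul_sub, sub_mul, mul_one, one_mul, smul_mul_assoc, mul_smul_comm, this]
  module

theorem phaseRotation_conjTranspose_mul_self {x : ι → ℂ} (hx : star x ⬝ᵥ x = 1) {z : ℂ}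
    (hz : ‖z‖ = 1) : (phaseRotation x z)ᴴ * phaseRotation x z = 1 := by
  rw [phaseRotation_conjTranspose, phaseRotation_mul hx]
  have : star z * z = 1 := by
    have := Complex.conj_mul' z
    rw [hz] at this; simpa using this
  rw [this, phaseRotation_one]

theorem phaseRotation_mem_unitaryGroup {x : ι → ℂ} (hx : star x ⬝ᵥ x = 1) {z : ℂ}
    (hz : ‖z‖ = 1) : phaseRotation x z ∈ Matrix.unitaryGroup ι ℂ :=
  Matrix.mem_unitaryGroup_iff'.2 (phaseRotation_conjTranspose_mul_self hx hz)

open scoped Matrix.Norms.L2Operator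

theorem sqrt_sqNorm_mulVec_le (A : Matrix ι ι ℂ) (v : ι → ℂ) :
    √(sqNorm (A *ᵥ v)) ≤ ‖A‖ * √(sqNorm v) := by
  simp only [sqNorm_eq_norm_sq, Real.sqrt_sq (norm_nonneg _)]
  exact Matrix.l2_opNorm_mulVec A (WithLp.toLp 2 v)

/-- Cauchy–Schwarz for the rank-one operator v ↦ ⟨y, v⟩ x. -/
theorem norm_vecMulVec_star_le (x y : ι → ℂ) :
    ‖Matrix.vecMulVec x (star y)‖ ≤ √(sqNorm x) * √(sqNorm y) := by
  rw [Matrix.l2_opNorm_def]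
  refine ContinuousLinearMap.opNorm_le_bound _ (by positivity) fun v => ?_
  have h1 : (Matrix.toEuclideanLin (𝕜 := ℂ) (Matrix.vecMulVec x (star y))) v =
      (inner ℂ (WithLp.toLp 2 y) v) • WithLp.toLp 2 x := by
    ext i
    simp [Matrix.toLpLin_apply, Matrix.vecMulVec_mulVec, EuclideanSpace.inner_eq_star_dotProduct,
      dotProduct_comm, mul_comm]
  simp only [sqNorm_eq_norm_sq, Real.sqrt_sq (norm_nonneg _)]
  calc _ = ‖(Matrix.toEuclideanLin (𝕜 := ℂ) (Matrix.vecMulVec x (star y))) v‖ := rfl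
    _ ≤ ‖WithLp.toLp 2 y‖ * ‖v‖ * ‖WithLp.toLp 2 x‖ := by
      rw [h1, norm_smul]; gcongr; exact norm_inner_le_norm _ _
    _ = _ := by ring

/-- Two reflections in nearby hyperplanes are close to each other. -/
theorem norm_phaseRotation_sub_le {x y : ι → ℂ} (hx : sqNorm x = 1) (hy : sqNorm y = 1) :
    ‖phaseRotation x (-1) - phaseRotation y (-1)‖ ≤ 4 * √(sqNorm (x - y)) := by
  -- The difference of projections is telescoped through y x†. Two terms, each with the factor 2 of
  -- a reflection, give the constant 4.
  have : phaseRotation x (-1) - phaseRotation y (-1) =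
      (-2 : ℂ) • (Matrix.vecMulVec (x - y) (star x) + Matrix.vecMulVec y (star (x - y))) := by
    simp only [phaseRotation, star_sub, Matrix.vecMulVec_sub, Matrix.sub_vecMulVec]
    module
  rw [this, norm_smul]
  have h1 := norm_vecMulVec_star_le (x - y) x
  have h2 := norm_vecMulVec_star_le y (x - y)
  rw [hx, Real.sqrt_one, mul_one] at h1
  rw [hy, Real.sqrt_one, one_mul] at h2
  have h3 := norm_add_le (Matrix.vecMulVec (x - y) (star x)) (Matrix.vecMulVec y (star (x - y)))
  have : ‖(-2 : ℂ)‖ = 2 := by simp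
  rw [this]; linarith

theorem norm_le_one_of_conjTranspose_mul_self {A : Matrix ι ι ℂ} (hA : Aᴴ * A = 1) :
    ‖A‖ ≤ 1 := by
  rw [Matrix.l2_opNorm_def]
  refine ContinuousLinearMap.opNorm_le_bound _ zero_le_one fun v => ?_
  have := sqNorm_mulVec_of_conjTranspose_mul_self A hA v.ofLp
  rw [sqNorm_eq_norm_sq, sqNorm_eq_norm_sq] at this
  rw [one_mul]
  exact ((sq_eq_sq₀ (norm_nonneg _) (norm_nonneg _)).1 this).le

end PhaseRotation

/-! ### Distance between oracles -/

section OracleDistance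

open scoped Matrix.Norms.L2Operator

variable {d w : ℕ}

theorem kronecker_one_mulVec (A : Matrix (Fin d) (Fin d) ℂ) (v : Fin d × Fin w → ℂ)
    (i : Fin d) (j : Fin w) :
    ((A ⊗ₖ (1 : Matrix (Fin w) (Fin w) ℂ)) *ᵥ v) (i, j) = (A *ᵥ fun i' => v (i', j)) i := by
  simp [Matrix.mulVec, dotProduct, Fintype.sum_prod_type, Matrix.one_apply]

theorem sqNorm_prod (v : Fin d × Fin w → ℂ) :
    sqNorm v = ∑ j, sqNorm fun i => v (i, j) := by
  simp only [sqNorm, Fintype.sum_prod_type]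
  exact Finset.sum_comm

/-- `A ⊗ₖ 1` acts on every workspace slice separately, and the squared norms of the slices add up.
-/
theorem sqrt_sqNorm_kronecker_one_mulVec_le (A : Matrix (Fin d) (Fin d) ℂ)
    (v : Fin d × Fin w → ℂ) :
    √(sqNorm ((A ⊗ₖ (1 : Matrix (Fin w) (Fin w) ℂ)) *ᵥ v)) ≤ ‖A‖ * √(sqNorm v) := by
  simp only [sqNorm_prod, kronecker_one_mulVec]
  have := sqrt_sum_le Finset.univ (f := fun j => sqNorm (A *ᵥ fun i => v (i, j)))
    (a := fun _ => 0) (b := fun j => sqNorm fun i => v (i, j)) (norm_nonneg A)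
    (fun _ => sqNorm_nonneg _) (fun _ => le_rfl) (fun _ => sqNorm_nonneg _)
    (fun j => by simpa using sqrt_sqNorm_mulVec_le A fun i => v (i, j))
  simpa using this

/-- Inverse queries are no easier to tell apart, since the adjoint preserves the operator norm. -/
theorem sqrt_sqNorm_oracle_sub_le (U V : Matrix.unitaryGroup (Fin d) ℂ) (inverse : Bool)
    (v : Fin d × Fin w → ℂ) :
    √(sqNorm ((oracle V inverse - oracle U inverse) *ᵥ v)) ≤
      ‖(V : Matrix (Fin d) (Fin d) ℂ) - U‖ * √(sqNorm v) := by
  have h : ∀ A B : Matrix (Fin d) (Fin d) ℂ, A ⊗ₖ (1 : Matrix (Fin w) (Fin w) ℂ) - B ⊗ₖ 1 =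
      (A - B) ⊗ₖ 1 := fun A B => by ext; simp [sub_mul]
  cases inverse
  · simp only [oracle, Bool.false_eq_true, if_false, h]
    exact sqrt_sqNorm_kronecker_one_mulVec_le _ v
  · simp only [oracle, if_true, h]
    rw [← Matrix.conjTranspose_sub]
    refine (sqrt_sqNorm_kronecker_one_mulVec_le _ v).trans_eq ?_
    rw [Matrix.l2_opNorm_conjTranspose]

end OracleDistance

/-! ### The hybrid argument -/

namespace Protocol

variable {d : ℕ} (P : Protocol d)

/-- Every branch state is linear in the initial vector, and the probability sums squared norms of
the accepted branches. Its square root is therefore a seminorm, which is why the hybrid argument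
works with square roots. -/
theorem sqrt_truncatedProb_add_le
    (O : Bool → Matrix (Fin d × Fin (P.work + 1)) (Fin d × Fin (P.work + 1)) ℂ) (b : Verdict)
    (n k : ℕ) (s : P.Mem) (v w : Fin d × Fin (P.work + 1) → ℂ) :
    √(P.truncatedProb O b n k s (v + w)) ≤
      √(P.truncatedProb O b n k s v) + √(P.truncatedProb O b n k s w) := by
  induction n generalizing k s v w with
  | zero => simp [truncatedProb]
  | succ n ih =>
    simp only [truncatedProb]
    cases P.action s with
    | halt b' => simp only; split
                 · exact sqrt_sqNorm_add_le v w
                 · simp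
    | query inv s' => cases k with
      | zero => simp
      | succ k => simp only [Matrix.mulVec_add]; exact ih _ _ _ _
    | process m K hK next =>
      have := sqrt_sum_le Finset.univ zero_le_one
        (f := fun o => P.truncatedProb O b n k (next o) (K o *ᵥ v + K o *ᵥ w))
        (a := fun o => P.truncatedProb O b n k (next o) (K o *ᵥ v))
        (b := fun o => P.truncatedProb O b n k (next o) (K o *ᵥ w))
        (fun _ => P.truncatedProb_nonneg _ _ _ _ _ _)
        (fun _ => P.truncatedProb_nonneg _ _ _ _ _ _)
        (fun _ => P.truncatedProb_nonneg _ _ _ _ _ _)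
        (fun o => by rw [one_mul]; exact ih _ _ _ _)
      simpa [Matrix.mulVec_add] using this

theorem truncatedProb_le_sqNorm (U : Matrix.unitaryGroup (Fin d) ℂ) (b : Verdict)
    (n k : ℕ) (s : P.Mem) (v : Fin d × Fin (P.work + 1) → ℂ) :
    P.truncatedProb (oracle U) b n k s v ≤ sqNorm v := by
  have := (P.ofReal_truncatedProb_le U b n k s v).trans (P.verdictProbIn_le_weight U b n s v)
  rw [weight_eq_ofReal] at this
  exact (ENNReal.ofReal_le_ofReal_iff (sqNorm_nonneg v)).1 this

/-- The hybrid argument: replacing `U` by `V` changes the outcome of `k` queries little. -/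
theorem sqrt_truncatedProb_le_add (U V : Matrix.unitaryGroup (Fin d) ℂ) (b : Verdict) {r : ℝ}
    (hr : 0 ≤ r) (hUV : ∀ inverse (v : Fin d × Fin (P.work + 1) → ℂ),
      √(sqNorm ((oracle V inverse - oracle U inverse) *ᵥ v)) ≤ r * √(sqNorm v))
    (n k : ℕ) (s : P.Mem) (v : Fin d × Fin (P.work + 1) → ℂ) :
    √(P.truncatedProb (oracle V) b n k s v) ≤
      √(P.truncatedProb (oracle U) b n k s v) + k * r * √(sqNorm v) := by
  induction n generalizing k s v with
  | zero => simp only [truncatedProb, Real.sqrt_zero, zero_add]; positivity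
  | succ n ih =>
    simp only [truncatedProb]
    cases P.action s with
    | halt b' => exact le_add_of_nonneg_right (by positivity)
    | query inv s' => cases k with
      | zero => simp
      | succ k =>
        simp only
        have h1 := ih k s' (oracle V inv *ᵥ v)
        -- Replacing this one query by U leaves an error vector. It contributes at most its norm,
        -- hence at most r times the norm of v.
        have h2 : oracle V inv *ᵥ v = oracle U inv *ᵥ v + (oracle V inv - oracle U inv) *ᵥ v := by
          rw [← Matrix.add_mulVec]; simp
        have h3 := P.sqrt_truncatedProb_add_le (oracle U) b n k s' (oracle U inv *ᵥ v)
          ((oracle V inv - oracle U inv) *ᵥ v)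
        rw [← h2] at h3
        have h4 := Real.sqrt_le_sqrt (P.truncatedProb_le_sqNorm U b n k s'
          ((oracle V inv - oracle U inv) *ᵥ v))
        have h5 := hUV inv v
        rw [sqNorm_oracle_mulVec] at h1
        push_cast
        linarith
    | process m K hK next =>
      -- The error of a branch is proportional to the norm of that branch, so Minkowski's inequality
      -- recombines the branches with the same factor k * r.
      have := sqrt_sum_le Finset.univ (by positivity : 0 ≤ k * r)
        (f := fun o => P.truncatedProb (oracle V) b n k (next o) (K o *ᵥ v))
        (a := fun o => P.truncatedProb (oracle U) b n k (next o) (K o *ᵥ v))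
        (b := fun o => sqNorm (K o *ᵥ v))
        (fun _ => P.truncatedProb_nonneg _ _ _ _ _ _)
        (fun _ => P.truncatedProb_nonneg _ _ _ _ _ _)
        (fun _ => sqNorm_nonneg _) (fun o => ih _ _ _)
      rwa [sum_sqNorm_mulVec K hK] at this

end Protocol

/-! ### Geometric coherence and the nearest incoherent preparation -/

section Coherence

variable {d : ℕ}

theorem star_basisVec_dotProduct (k : Fin d) (ψ : Fin d → ℂ) : star (basisVec k) ⬝ᵥ ψ = ψ k := by
  rw [basisVec, Pi.star_single, star_one, single_one_dotProduct]

theorem geometricCoherence_eq (ψ : Fin d → ℂ) :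
    geometricCoherence ψ = 1 - ⨆ k : Fin d, ‖ψ k‖ ^ 2 := by
  simp only [geometricCoherence, star_basisVec_dotProduct]

theorem sqNorm_basisVec (k : Fin d) : sqNorm (basisVec k) = 1 := sqNorm_single k

theorem geometricCoherence_le (ψ : Fin d → ℂ) (k : Fin d) :
    geometricCoherence ψ ≤ 1 - ‖ψ k‖ ^ 2 := by
  rw [geometricCoherence_eq]
  exact sub_le_sub_left (le_ciSup (f := fun k => ‖ψ k‖ ^ 2) (Set.finite_range _).bddAbove k) 1

theorem isIncoherent_of_norm_eq_one {ψ : Fin d → ℂ} (hψ : sqNorm ψ = 1) {k : Fin d}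
    (hk : 1 ≤ ‖ψ k‖ ^ 2) : IsIncoherent ψ := by
  have h1 : ∑ i ∈ Finset.univ.erase k, ‖ψ i‖ ^ 2 + ‖ψ k‖ ^ 2 = 1 := by
    rw [Finset.sum_erase_add _ _ (Finset.mem_univ k)]; exact hψ
  have h2 : 0 ≤ ∑ i ∈ Finset.univ.erase k, ‖ψ i‖ ^ 2 :=
    Finset.sum_nonneg fun _ _ => by positivity
  have h3 : ∑ i ∈ Finset.univ.erase k, ‖ψ i‖ ^ 2 = 0 := by linarith
  rw [Finset.sum_eq_zero_iff_of_nonneg fun _ _ => by positivity] at h3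
  refine ⟨k, ψ k, ?_, ?_⟩
  · rw [← sq_eq_sq₀ (norm_nonneg _) zero_le_one]; linarith
  · ext i
    by_cases hi : i = k
    · subst hi; simp [basisVec]
    · have := h3 i (by simp [hi])
      simp [basisVec, hi] at this ⊢
      exact this

/-- Coherence 1 would make every amplitude vanish. -/
theorem geometricCoherence_lt_one {ψ : Fin d → ℂ} (hψ : sqNorm ψ = 1) :
    geometricCoherence ψ < 1 := by
  by_contra! hc
  have : sqNorm ψ = 0 := Finset.sum_eq_zero fun k _ =>
    le_antisymm (by have := geometricCoherence_le ψ k; linarith) (by positivity)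
  linarith

-- The reflection S_y is an involution, so A − S_x S_y A = (S_y − S_x) S_y A, where S_y A is an
-- isometry. This bounds the cost of rotating the prepared state by two reflections.
open scoped Matrix.Norms.L2Operator in
theorem norm_sub_mul_mul_le {x y : Fin d → ℂ} (hx : sqNorm x = 1) (hy : sqNorm y = 1)
    {A : Matrix (Fin d) (Fin d) ℂ} (hA : Aᴴ * A = 1) :
    ‖A - phaseRotation x (-1) * phaseRotation y (-1) * A‖ ≤ 4 * √(sqNorm (x - y)) := by
  have hyy : star y ⬝ᵥ y = 1 := by rw [← sqNorm_eq_dotProduct, hy]; simp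
  have hS : phaseRotation y (-1) * phaseRotation y (-1) = 1 := by
    rw [phaseRotation_mul hyy, neg_mul_neg, one_mul, phaseRotation_one]
  have h1 : A - phaseRotation x (-1) * phaseRotation y (-1) * A =
      (phaseRotation y (-1) - phaseRotation x (-1)) * (phaseRotation y (-1) * A) := by
    rw [sub_mul, ← mul_assoc, ← mul_assoc, hS, one_mul]
  have h2 : ‖phaseRotation y (-1) * A‖ ≤ 1 := by
    refine norm_le_one_of_conjTranspose_mul_self ?_
    rw [Matrix.conjTranspose_mul, mul_assoc, ← mul_assoc _ _ A,
      phaseRotation_conjTranspose_mul_self hyy (by simp), one_mul, hA]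
  rw [h1, ← mul_one (4 * √(sqNorm (x - y)))]
  refine (Matrix.l2_opNorm_mul _ _).trans (mul_le_mul ?_ h2 (norm_nonneg _) (by positivity))
  rw [norm_sub_rev]
  exact norm_phaseRotation_sub_le hx hy

variable [NeZero d]

theorem sqNorm_preparedState (U : Matrix.unitaryGroup (Fin d) ℂ) :
    sqNorm (preparedState U) = 1 := by
  rw [preparedState, sqNorm_mulVec_of_conjTranspose_mul_self _
    (Matrix.UnitaryGroup.star_mul_self U), sqNorm_basisVec]

theorem exists_norm_sq_eq (ψ : Fin d → ℂ) : ∃ k, ‖ψ k‖ ^ 2 = 1 - geometricCoherence ψ := by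
  obtain ⟨k, hk⟩ := exists_eq_ciSup_of_finite (f := fun k => ‖ψ k‖ ^ 2)
  exact ⟨k, by rw [geometricCoherence_eq, ← hk]; ring⟩

theorem geometricCoherence_pos {ψ : Fin d → ℂ} (hψ : sqNorm ψ = 1) (h : ¬ IsIncoherent ψ) :
    0 < geometricCoherence ψ := by
  obtain ⟨k, hk⟩ := exists_norm_sq_eq ψ
  by_contra hc
  exact h (isIncoherent_of_norm_eq_one hψ (k := k) (by linarith))

open scoped Matrix.Norms.L2Operator

/-- A unitary that prepares a state of geometric coherence `c` is within `4 √c` of a unitary that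
prepares an incoherent state. -/
theorem exists_incoherent_norm_sub_le (U : Matrix.unitaryGroup (Fin d) ℂ) :
    ∃ V : Matrix.unitaryGroup (Fin d) ℂ, IsIncoherent (preparedState V) ∧
      ‖(U : Matrix (Fin d) (Fin d) ℂ) - V‖ ≤ 4 * √(geometricCoherence (preparedState U)) := by
  set ψ := preparedState U with hψdef
  have hψ : sqNorm ψ = 1 := sqNorm_preparedState U
  obtain ⟨k, hk⟩ := exists_norm_sq_eq ψ
  have hc := geometricCoherence_lt_one hψ
  set a := ‖ψ k‖ with ha
  have ha0 : 0 < a := by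
    rcases (norm_nonneg (ψ k)).eq_or_lt with h | h
    · rw [← ha] at h; rw [← h] at hk; simp at hk; linarith
    · exact h
  have ha1 : a ≤ 1 := by
    have : a ^ 2 ≤ 1 := by
      have := Finset.single_le_sum (f := fun i => ‖ψ i‖ ^ 2) (fun _ _ => by positivity)
        (Finset.mem_univ k)
      exact this.trans hψ.le
    nlinarith
  have hψψ : star ψ ⬝ᵥ ψ = 1 := by rw [← sqNorm_eq_dotProduct, hψ]; simp
  -- The phase is aligned with ψ k, so that the overlap of e with ψ is the positive number a.
  set z : ℂ := ψ k / a with hz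
  have haC : (a : ℂ) ≠ 0 := by exact_mod_cast ha0.ne'
  have hz1 : ‖z‖ = 1 := by
    rw [hz, norm_div, Complex.norm_real, Real.norm_of_nonneg ha0.le, ← ha, div_self ha0.ne']
  set e : Fin d → ℂ := z • basisVec k with he
  have hee : star e ⬝ᵥ e = 1 := by
    rw [← sqNorm_eq_dotProduct, he, sqNorm_smul, hz1, sqNorm_basisVec]; simp
  have heψ : star e ⬝ᵥ ψ = a := by
    rw [he, star_smul, smul_dotProduct, star_basisVec_dotProduct, hz, smul_eq_mul, star_div₀]
    have := Complex.conj_mul' (ψ k)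
    rw [← ha] at this
    simp only [RCLike.star_def, Complex.conj_ofReal]
    field_simp
    linear_combination this
  have hψe : star ψ ⬝ᵥ e = a := by
    rw [Matrix.star_dotProduct, heψ, RCLike.star_def, Complex.conj_ofReal]
  set s : ℝ := √(2 + 2 * a) with hs
  have hs2 : s ^ 2 = 2 + 2 * a := Real.sq_sqrt (by linarith)
  have hs0 : 0 < s := Real.sqrt_pos.2 (by linarith)
  have hsC : (s : ℂ) ≠ 0 := by exact_mod_cast hs0.ne'
  have hs2C : (s : ℂ) ^ 2 = 2 + 2 * a := by exact_mod_cast hs2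
  -- The unit bisector of ψ and e, where s is the norm of ψ + e. Reflecting in ψ and then in u sends
  -- ψ to −ψ and then to e.
  set u : Fin d → ℂ := (s : ℂ)⁻¹ • (ψ + e) with hu
  have hsu : star u = (s : ℂ)⁻¹ • (star ψ + star e) := by
    rw [hu, star_smul, star_add]; simp
  have huψ : star u ⬝ᵥ ψ = s / 2 := by
    rw [hsu, smul_dotProduct, add_dotProduct, hψψ, heψ, smul_eq_mul]
    field_simp
    linear_combination - hs2C
  have hψu : star ψ ⬝ᵥ u = s / 2 := by
    rw [hu, dotProduct_smul, dotProduct_add, hψψ, hψe, smul_eq_mul]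
    field_simp
    linear_combination - hs2C
  have huu : star u ⬝ᵥ u = 1 := by
    rw [hsu, hu, dotProduct_smul, smul_dotProduct, add_dotProduct, dotProduct_add, dotProduct_add,
      hψψ, heψ, hψe, hee, smul_eq_mul, smul_eq_mul]
    field_simp
    linear_combination - hs2C
  have hu1 : sqNorm u = 1 := by
    have := sqNorm_eq_dotProduct u
    rw [huu] at this; exact_mod_cast this
  have hdist : sqNorm (u - ψ) = 2 - s := by
    have := sqNorm_eq_dotProduct (u - ψ)
    rw [star_sub, sub_dotProduct, dotProduct_sub, dotProduct_sub, hψψ, huu, huψ, hψu] at this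
    have h2 : (sqNorm (u - ψ) : ℂ) = ((2 - s : ℝ) : ℂ) := by
      rw [this]; push_cast; ring
    exact_mod_cast h2
  have hdist' : sqNorm (u - ψ) ≤ geometricCoherence ψ := by
    rw [hdist]
    -- Hence 2 − s ≤ 1 − a ≤ 1 − a² = c.
    have : 1 + a ≤ s := Real.le_sqrt_of_sq_le (by nlinarith)
    nlinarith
  have hn : ‖(-1 : ℂ)‖ = 1 := by simp
  have hRψ : (phaseRotation u (-1) * phaseRotation ψ (-1)) *ᵥ ψ = e := by
    have h1 : phaseRotation ψ (-1) *ᵥ ψ = -ψ := by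
      rw [phaseRotation_mulVec, hψψ]; module
    have h2 : phaseRotation u (-1) *ᵥ ψ = -e := by
      rw [phaseRotation_mulVec, huψ, hu, smul_smul]
      have : (1 - -1) * ((s : ℂ) / 2) * (s : ℂ)⁻¹ = 1 := by field_simp; norm_num
      rw [this]; module
    rw [← Matrix.mulVec_mulVec, h1, Matrix.mulVec_neg, h2, neg_neg]
  let R : Matrix.unitaryGroup (Fin d) ℂ :=
    ⟨phaseRotation u (-1), phaseRotation_mem_unitaryGroup huu hn⟩ *
      ⟨phaseRotation ψ (-1), phaseRotation_mem_unitaryGroup hψψ hn⟩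
  refine ⟨R * U, ⟨k, z, hz1, ?_⟩, ?_⟩
  · rw [preparedState, Matrix.UnitaryGroup.mul_val, ← Matrix.mulVec_mulVec]
    exact hRψ
  · rw [Matrix.UnitaryGroup.mul_val]
    refine (norm_sub_mul_mul_le hu1 hψ (Matrix.UnitaryGroup.star_mul_self U)).trans ?_
    gcongr

/-- Detecting one coherent state, with a bounded false alarm rate on incoherent states, takes
`Ω(c ^ (-1/2))` queries on average. -/
theorem Protocol.ofReal_le_expectedQueries_of_detects {δ : ℝ} (hδ0 : 0 < δ) (hδ : δ < 1 / 2)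
    (P : Protocol d)
    (hP : ∀ U, IsIncoherent (preparedState U) → P.verdictProb U .coherent ≤ ENNReal.ofReal δ)
    (U : Matrix.unitaryGroup (Fin d) ℂ) (hU : ¬ IsIncoherent (preparedState U))
    (hUc : ENNReal.ofReal (1 - δ) ≤ P.verdictProb U .coherent) :
    ENNReal.ofReal ((√(1 / 2) - √δ) * (1 - 2 * δ) / 16 / √(geometricCoherence (preparedState U)))
      ≤ P.expectedQueries U := by
  set c := geometricCoherence (preparedState U) with hcdef
  have hc : 0 < c := geometricCoherence_pos (sqNorm_preparedState U) hU
  rcases eq_or_ne (P.expectedQueries U) ∞ with htop | htop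
  · rw [htop]; exact le_top
  set T := (P.expectedQueries U).toReal with hT
  have hT0 : 0 ≤ T := ENNReal.toReal_nonneg
  -- Chosen so that 1 − δ − 2η = 1/2: one η buys the strict inequality, the other pays for Markov's
  -- inequality.
  set η := (1 - 2 * δ) / 4 with hη
  have hη0 : 0 < η := by rw [hη]; linarith
  set N := ⌊T / η⌋₊ with hN
  have hN1 : T ≤ η * (N + 1) := by
    have := (Nat.lt_floor_add_one (T / η)).le
    rw [div_le_iff₀ hη0] at this; linarith
  have hN2 : N * η ≤ T := by
    have := Nat.floor_le (div_nonneg hT0 hη0.le)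
    rwa [le_div_iff₀ hη0] at this
  obtain ⟨n, hn⟩ := P.exists_le_truncatedProb U .coherent (p := 1 - δ - η) (η := η) N
    (lt_of_lt_of_le ((ENNReal.ofReal_lt_ofReal_iff (by linarith)).2 (by linarith)) hUc) hη0.le
    (by rw [← ENNReal.ofReal_toReal htop]; exact ENNReal.ofReal_le_ofReal hN1)
  obtain ⟨V, hV, hUV⟩ := exists_incoherent_norm_sub_le U
  have h1 := P.sqrt_truncatedProb_le_add V U .coherent (r := 4 * √c) (by positivity)
    (fun inverse v => (sqrt_sqNorm_oracle_sub_le V U inverse v).trans (by gcongr)) n N P.start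
    P.initial
  have h2 : P.truncatedProb (oracle V) .coherent n N P.start P.initial ≤ δ := by
    have := (P.ofReal_truncatedProb_le V .coherent n N P.start P.initial).trans
      ((le_iSup (fun n => P.verdictProbIn V .coherent n P.start P.initial) n).trans (hP V hV))
    exact (ENNReal.ofReal_le_ofReal_iff hδ0.le).1 this
  have h3 : √(1 / 2) ≤ √δ + N * (4 * √c) := by
    calc √(1 / 2) ≤ _ := Real.sqrt_le_sqrt (le_trans (by rw [hη]; linarith) hn)
      _ ≤ _ := h1
      _ ≤ _ := by rw [P.sqNorm_initial]; simp only [Real.sqrt_one, mul_one]; gcongr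
  rw [← ENNReal.ofReal_toReal htop]
  refine ENNReal.ofReal_le_ofReal ?_
  have hsc : 0 < √c := Real.sqrt_pos.2 hc
  rw [div_le_iff₀ hsc]
  calc (√(1 / 2) - √δ) * (1 - 2 * δ) / 16 = (√(1 / 2) - √δ) * η / 4 := by rw [hη]; ring
    _ ≤ (N * (4 * √c)) * η / 4 := by gcongr; linarith
    _ = N * η * √c := by ring
    _ ≤ _ := by gcongr

end Coherence

/-! ### Chebyshev growth and polynomials on the unit circle -/

section Chebyshev

open Polynomial

/-- From cosh x = 1 + 2 sinh²(x/2). It bounds s by √(2(t − 1)) when cosh s = t, which yields the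
square-root rate in the growth bound. -/
theorem Real.one_add_sq_div_two_le_cosh (x : ℝ) : 1 + x ^ 2 / 2 ≤ Real.cosh x := by
  have h1 : x = 2 * (x / 2) := by ring
  have h2 : (x / 2) ^ 2 ≤ Real.sinh (x / 2) ^ 2 := by
    rw [sq_le_sq, Real.abs_sinh]
    exact Real.self_le_sinh_iff.2 (abs_nonneg _)
  rw [h1, Real.cosh_two_mul, Real.cosh_sq]
  linarith

/-- Chebyshev's bound for the growth of a real polynomial outside an interval where it is
bounded. -/
theorem Polynomial.eval_le_mul_exp {q : ℝ[X]} {N : ℕ} (hq : q.natDegree ≤ N) {l r x M : ℝ}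
    (hlr : l < r) (hx : r ≤ x) (hM : 0 < M) (hbound : ∀ t ∈ Set.Icc l r, |q.eval t| ≤ M) :
    q.eval x ≤ M * Real.exp (N * √(4 * (x - r) / (r - l))) := by
  -- Normalization: [l, r] is pulled back to [-1, 1] and the bound M to 1.
  set p : ℝ[X] := C M⁻¹ * q.comp (C ((l + r) / 2) + C ((r - l) / 2) * X) with hp
  have heval : ∀ t, p.eval t = M⁻¹ * q.eval ((l + r) / 2 + (r - l) / 2 * t) := by
    intro t; simp [hp]
  have hdeg : p.degree ≤ N := by
    refine natDegree_le_iff_degree_le.1 ((natDegree_C_mul_le _ _).trans ?_)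
    refine natDegree_comp_le.trans ?_
    have : (C ((l + r) / 2) + C ((r - l) / 2) * X : ℝ[X]).natDegree ≤ 1 := by
      compute_degree
    calc _ ≤ N * 1 := Nat.mul_le_mul hq this
      _ = N := mul_one N
  have hrl : 0 < r - l := by linarith
  set t₀ : ℝ := 1 + 2 * (x - r) / (r - l) with ht₀
  have ht₀1 : 1 ≤ t₀ := le_add_of_nonneg_right (div_nonneg (by linarith) hrl.le)
  have key := Polynomial.Chebyshev.eval_iterate_derivative_le_of_forall_abs_le_one (k := 0)
    ht₀1 hdeg (fun t ht => by
      rw [heval, abs_mul, abs_of_pos (inv_pos.2 hM), inv_mul_le_iff₀ hM, mul_one]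
      exact hbound _ ⟨by nlinarith [ht.1], by nlinarith [ht.2]⟩)
  simp only [Function.iterate_zero, id] at key
  have hx' : (l + r) / 2 + (r - l) / 2 * t₀ = x := by rw [ht₀]; field_simp; ring
  rw [heval, hx', inv_mul_le_iff₀ hM] at key
  refine key.trans ?_
  gcongr
  -- With t₀ = cosh s the Chebyshev polynomial takes the value cosh(N s) ≤ exp(N s).
  obtain ⟨s, hs0, hs⟩ : ∃ s, 0 ≤ s ∧ Real.cosh s = t₀ :=
    ⟨Real.arcosh t₀, Real.arcosh_nonneg ht₀1, Real.cosh_arcosh ht₀1⟩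
  rw [← hs]
  have := Polynomial.Chebyshev.T_real_cosh s N
  rw [this]
  have hs2 : s ≤ √(4 * (x - r) / (r - l)) := by
    refine Real.le_sqrt_of_sq_le ?_
    have h1 := Real.one_add_sq_div_two_le_cosh s
    rw [hs, ht₀] at h1
    have : 4 * (x - r) / (r - l) = 2 * (2 * (x - r) / (r - l)) := by ring
    rw [this]; linarith
  have hNs : 0 ≤ (N : ℝ) * s := by positivity
  push_cast
  calc Real.cosh (N * s) ≤ Real.exp (N * s) := by
        have := Real.sinh_nonneg_iff.2 hNs
        linarith [Real.cosh_add_sinh (N * s)]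
    _ ≤ _ := by gcongr

/-- For z = exp(iθ) both sides are 2 cos(kθ). -/
theorem pow_add_star_pow {z : ℂ} (hz : ‖z‖ = 1) (k : ℕ) :
    z ^ k + star z ^ k = ((2 * (Chebyshev.T ℝ k).eval z.re : ℝ) : ℂ) := by
  obtain ⟨θ, rfl⟩ : ∃ θ : ℝ, z = Complex.exp (θ * Complex.I) := by
    have := Complex.norm_mul_exp_arg_mul_I z
    rw [hz] at this
    exact ⟨z.arg, by simpa using this.symm⟩
  have h1 : star (Complex.exp (θ * Complex.I)) = Complex.exp (-θ * Complex.I) := by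
    rw [RCLike.star_def, ← Complex.exp_conj]; simp
  rw [Complex.exp_ofReal_mul_I_re, Chebyshev.T_real_cos, h1, ← Complex.exp_nat_mul,
    ← Complex.exp_nat_mul]
  push_cast
  rw [Complex.two_cos]
  congr 2 <;> ring

/-- Since z^k plus its conjugate is real, only the real parts of the coefficients survive, and each
monomial becomes a Chebyshev polynomial of the same degree. -/
theorem exists_eval_re_eq_re_add (Q : ℂ[X]) : ∃ q : ℝ[X], q.natDegree ≤ Q.natDegree ∧
    ∀ z : ℂ, ‖z‖ = 1 → (Q.eval z).re + (Q.eval (star z)).re = q.eval z.re := by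
  refine ⟨∑ k ∈ Finset.range (Q.natDegree + 1), C (2 * (Q.coeff k).re) * Chebyshev.T ℝ k,
    natDegree_sum_le_of_forall_le _ _ fun k hk => (natDegree_C_mul_le _ _).trans ?_,
    fun z hz => ?_⟩
  · rw [Chebyshev.natDegree_T]
    simpa [Nat.lt_succ_iff] using hk
  · rw [eval_finsetSum, eval_eq_sum_range, eval_eq_sum_range, ← Complex.add_re,
      ← Finset.sum_add_distrib, Complex.re_sum]
    refine Finset.sum_congr rfl fun k _ => ?_
    rw [← mul_add, pow_add_star_pow hz, Complex.re_mul_ofReal, eval_mul, eval_C]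
    ring

/-- The symmetrized squared modulus of a complex polynomial on the unit circle is a real
polynomial in the real part. -/
theorem exists_eval_re_eq_norm_sq_add {m : ℕ} (Q : ℂ[X]) (hQ : Q.natDegree ≤ m) :
    ∃ q : ℝ[X], q.natDegree ≤ m ∧
      ∀ z : ℂ, ‖z‖ = 1 → ‖Q.eval z‖ ^ 2 + ‖Q.eval (star z)‖ ^ 2 = q.eval z.re := by
  induction m generalizing Q with
  | zero =>
    rw [eq_C_of_natDegree_le_zero hQ]
    exact ⟨C (2 * ‖Q.coeff 0‖ ^ 2), (natDegree_C _).le, fun z _ => by simp only [eval_C]; ring⟩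
  | succ m ih =>
    -- With Q = X R + a, on the circle |Q|² = |R|² + 2 Re(ā z R) + |a|². Peeling off the constant
    -- term in this way keeps the degree at m instead of 2m.
    obtain ⟨q₁, hq₁, h₁⟩ := ih Q.divX (by rw [natDegree_divX_eq_natDegree_tsub_one]; omega)
    obtain ⟨q₂, hq₂, h₂⟩ := exists_eval_re_eq_re_add (C (2 * star (Q.coeff 0)) * (X * Q.divX))
    refine ⟨q₁ + q₂ + C (2 * ‖Q.coeff 0‖ ^ 2), ?_, fun z hz => ?_⟩
    · have : (C (2 * star (Q.coeff 0)) * (X * Q.divX)).natDegree ≤ m + 1 := by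
        refine (natDegree_C_mul_le _ _).trans (natDegree_mul_le.trans ?_)
        rw [natDegree_X, natDegree_divX_eq_natDegree_tsub_one]; omega
      refine (natDegree_add_le_of_degree_le (natDegree_add_le_of_degree_le
        (hq₁.trans (Nat.le_succ m)) (hq₂.trans this)) ((natDegree_C _).le.trans (Nat.zero_le _)))
    · have key : ∀ w : ℂ, ‖w‖ = 1 → ‖Q.eval w‖ ^ 2 = ‖Q.divX.eval w‖ ^ 2 +
          ((C (2 * star (Q.coeff 0)) * (X * Q.divX)).eval w).re + ‖Q.coeff 0‖ ^ 2 := by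
        intro w hw
        conv_lhs => rw [← divX_mul_X_add Q]
        simp only [eval_add, eval_mul, eval_X, eval_C]
        have hw2 : w.re * w.re + w.im * w.im = 1 := by
          have := Complex.sq_norm w
          rw [hw, Complex.normSq_apply] at this; linarith
        simp only [Complex.sq_norm, Complex.normSq_apply, Complex.add_re, Complex.add_im,
          Complex.mul_re, Complex.mul_im, RCLike.star_def, Complex.conj_re, Complex.conj_im,
          Complex.re_ofNat, Complex.im_ofNat]
        generalize (eval w Q.divX).re = a
        generalize (eval w Q.divX).im = b
        linear_combination (a ^ 2 + b ^ 2) * hw2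
      rw [key z hz, key (star z) (by simpa using hz), eval_add, eval_add, eval_C,
        ← h₁ z hz, ← h₂ z hz]
      ring

end Chebyshev

/-! ### The polynomial method for phase oracles -/

namespace Protocol

open Polynomial

variable {d : ℕ} (P : Protocol d)

/-- The black box that answers queries with the phase rotation `phaseRotation u z`. -/
def phaseOracle {w : ℕ} (u : Fin d → ℂ) (z : ℂ) (inverse : Bool) :
    Matrix (Fin d × Fin w) (Fin d × Fin w) ℂ :=
  phaseRotation u (if inverse then star z else z) ⊗ₖ 1

theorem oracle_phaseRotation {w : ℕ} {u : Fin d → ℂ} {z : ℂ}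
    (h : phaseRotation u z ∈ Matrix.unitaryGroup (Fin d) ℂ) :
    oracle (w := w) ⟨phaseRotation u z, h⟩ = phaseOracle u z := by
  funext inverse
  cases inverse <;> simp [oracle, phaseOracle, phaseRotation_conjTranspose]

/-- On the unit circle the inverse query is (1 − E) + z⁻¹E = z⁻¹(E + z(1 − E)), with E the
projection onto u tensored with the identity when u is a unit vector. Pulling out the unimodular
factor leaves a matrix affine in z, so amplitudes stay polynomial and gain at most one degree per
query. -/
theorem phaseOracle_eq {w : ℕ} (u : Fin d → ℂ) : ∃ A B : Bool → Matrix (Fin d × Fin w) _ ℂ,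
    ∀ z : ℂ, ‖z‖ = 1 → ∀ inverse, phaseOracle u z inverse =
      (z⁻¹) ^ (if inverse then 1 else 0) • (A inverse + z • B inverse) := by
  let E : Matrix (Fin d × Fin w) (Fin d × Fin w) ℂ := Matrix.vecMulVec u (star u) ⊗ₖ 1
  have hE : ∀ z, phaseRotation u z ⊗ₖ (1 : Matrix (Fin w) (Fin w) ℂ) = 1 - (1 - z) • E := by
    intro z
    ext ⟨i, j⟩ ⟨i', j'⟩
    simp only [phaseRotation, Matrix.kroneckerMap_apply, Matrix.sub_apply, Matrix.smul_apply,
      Matrix.one_apply, Prod.mk.injEq, E]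
    split_ifs <;> simp_all
  refine ⟨fun inverse => if inverse then E else 1 - E, fun inverse => if inverse then 1 - E else E,
    fun z hz inverse => ?_⟩
  have hz0 : z ≠ 0 := by rintro rfl; simp at hz
  have hz' : star z = z⁻¹ := by
    rw [Complex.inv_def, Complex.normSq_eq_norm_sq, hz]; simp
  cases inverse
  · simp only [phaseOracle, hE, Bool.false_eq_true, if_false]
    module
  · simp only [phaseOracle, hE, if_true, hz', pow_one, smul_add, smul_smul, inv_mul_cancel₀ hz0]
    module

/-- On the unit circle of phase rotations, the symmetrized probability of a verdict within `k`
queries is a polynomial of degree `k` in the real part of the phase. -/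
theorem exists_truncatedProb_add_eq_eval (u : Fin d → ℂ) (b : Verdict) (n k m a : ℕ) (s : P.Mem)
    (V : Fin d × Fin (P.work + 1) → ℂ[X]) (hV : ∀ i, (V i).natDegree ≤ m) :
    ∃ q : ℝ[X], q.natDegree ≤ m + k ∧ ∀ z : ℂ, ‖z‖ = 1 →
      P.truncatedProb (phaseOracle u z) b n k s (z⁻¹ ^ a • fun i => (V i).eval z) +
        P.truncatedProb (phaseOracle u (star z)) b n k s
          ((star z)⁻¹ ^ a • fun i => (V i).eval (star z)) = q.eval z.re := by
  induction n generalizing k m a s V with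
  | zero => exact ⟨0, by simp, fun z _ => by simp [truncatedProb]⟩
  | succ n ih =>
    simp only [truncatedProb]
    cases P.action s with
    | halt b' =>
      simp only
      split
      · choose q hq h using fun i => exists_eval_re_eq_norm_sq_add (V i) (hV i)
        refine ⟨∑ i, q i, (natDegree_sum_le_of_forall_le _ _ fun i _ => hq i).trans le_self_add,
          fun z hz => ?_⟩
        -- The prefactor z⁻ᵃ has modulus one and drops out of the probability.
        rw [sqNorm_smul, sqNorm_smul, eval_finsetSum]
        simp only [norm_pow, norm_inv, norm_star, hz, inv_one, one_pow, one_mul, sqNorm]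
        rw [← Finset.sum_add_distrib]
        exact Finset.sum_congr rfl fun i _ => h i z hz
      · exact ⟨0, by simp, fun z _ => by simp⟩
    | query inv s' => cases k with
      | zero => exact ⟨0, by simp, fun z _ => by simp⟩
      | succ k =>
        simp only
        obtain ⟨A, B, hAB⟩ := phaseOracle_eq (w := P.work + 1) u
        -- One query trades a unit of budget for a unit of degree, keeping m + k fixed; an inverse
        -- query also adds one to the exponent a.
        obtain ⟨q, hq, h⟩ := ih k (m + 1) (a + if inv then 1 else 0) s'
          (fun i => ∑ j, (C (A inv i j) + X * C (B inv i j)) * V j) (fun i => by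
            refine natDegree_sum_le_of_forall_le _ _ fun j _ => natDegree_mul_le.trans ?_
            have : (C (A inv i j) + X * C (B inv i j)).natDegree ≤ 1 := by compute_degree
            have := hV j
            omega)
        refine ⟨q, by omega, fun z hz => ?_⟩
        have key : ∀ w : ℂ, ‖w‖ = 1 → phaseOracle u w inv *ᵥ (w⁻¹ ^ a • fun i => (V i).eval w) =
            w⁻¹ ^ (a + if inv then 1 else 0) • fun i =>
              (∑ j, (C (A inv i j) + X * C (B inv i j)) * V j).eval w := by
          intro w hw
          rw [hAB w hw, Matrix.mulVec_smul, Matrix.smul_mulVec, smul_smul, ← pow_add]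
          congr 1
          ext i
          simp [Matrix.mulVec, dotProduct, eval_finsetSum, mul_comm w]
        rw [key z hz, key (star z) (by simpa using hz)]
        exact h z hz
    | process l K hK next =>
      simp only
      choose q hq h using fun o => ih k m a (next o) (fun i => ∑ j, C (K o i j) * V j) (fun i =>
        natDegree_sum_le_of_forall_le _ _ fun j _ => (natDegree_C_mul_le _ _).trans (hV j))
      refine ⟨∑ o, q o, natDegree_sum_le_of_forall_le _ _ fun o _ => hq o, fun z hz => ?_⟩
      have key : ∀ (w : ℂ) o, K o *ᵥ (w⁻¹ ^ a • fun i => (V i).eval w) =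
          w⁻¹ ^ a • fun i => (∑ j, C (K o i j) * V j).eval w := by
        intro w o
        rw [Matrix.mulVec_smul]
        congr 1
        ext i
        simp [Matrix.mulVec, dotProduct, eval_finsetSum]
      rw [eval_finsetSum, ← Finset.sum_add_distrib]
      refine Finset.sum_congr rfl fun o _ => ?_
      rw [key, key]
      exact h o z hz

end Protocol

/-! ### A family of coherent states ending at an incoherent one -/

section BalancedVector

variable {d : ℕ} [NeZero d]

/-- The unit vector `(|0⟩ + φ) / √2`, where `φ` is the uniform superposition of the other basis
vectors. -/
noncomputable def balancedVec (d : ℕ) [NeZero d] : Fin d → ℂ := fun i =>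
  if i = 0 then ((√(1 / 2) : ℝ) : ℂ) else ((√(1 / (2 * (d - 1))) : ℝ) : ℂ)

theorem sqNorm_balancedVec (hd : 2 ≤ d) : sqNorm (balancedVec d) = 1 := by
  have hd' : (2 : ℝ) ≤ d := by exact_mod_cast hd
  have h1 : ∀ i : Fin d, ‖balancedVec d i‖ ^ 2 =
      if i = 0 then 1 / 2 else 1 / (2 * ((d : ℝ) - 1)) := by
    intro i
    unfold balancedVec
    split_ifs
    · rw [Complex.norm_real, Real.norm_of_nonneg (Real.sqrt_nonneg _),
        Real.sq_sqrt (by norm_num)]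
    · rw [Complex.norm_real, Real.norm_of_nonneg (Real.sqrt_nonneg _),
        Real.sq_sqrt (div_nonneg zero_le_one (by linarith))]
  rw [sqNorm, ← Finset.add_sum_erase _ _ (Finset.mem_univ (0 : Fin d)), h1, if_pos rfl,
    Finset.sum_congr rfl fun i hi => (h1 i).trans (if_neg (Finset.ne_of_mem_erase hi)),
    Finset.sum_const, Finset.card_erase_of_mem (Finset.mem_univ _), Finset.card_univ,
    Fintype.card_fin, nsmul_eq_mul, Nat.cast_sub (by omega)]
  have : (d : ℝ) - 1 ≠ 0 := by linarith
  push_cast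
  field_simp
  norm_num

theorem star_balancedVec_dotProduct : star (balancedVec d) ⬝ᵥ basisVec 0 = (√(1 / 2) : ℝ) := by
  rw [basisVec, dotProduct_single_one]
  simp [balancedVec]

/-- The rotated state has population (1 + Re z)/2 on |0⟩, and the remaining (1 − Re z)/2 is spread
evenly over the d − 1 other basis vectors. The two hypotheses bound these populations by 1 − ε. -/
theorem le_geometricCoherence_phaseRotation {z : ℂ} (hz : ‖z‖ = 1) {ε : ℝ}
    (h₀ : (1 + z.re) / 2 ≤ 1 - ε) (h₁ : (1 - z.re) / 2 ≤ (d - 1) * (1 - ε)) :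
    ε ≤ geometricCoherence (phaseRotation (balancedVec d) z *ᵥ basisVec 0) := by
  rw [geometricCoherence_eq, le_sub_comm]
  refine ciSup_le fun k => ?_
  rw [phaseRotation_mulVec, star_balancedVec_dotProduct]
  have hz2 : z.re * z.re + z.im * z.im = 1 := by
    have := Complex.sq_norm z
    rw [hz, Complex.normSq_apply] at this; linarith
  have hs : √(1 / 2) * √(1 / 2) = 1 / 2 := Real.mul_self_sqrt (by norm_num)
  by_cases hk : k = 0
  · subst hk
    have : (basisVec 0 - ((1 - z) * (√(1 / 2) : ℝ)) • balancedVec d : Fin d → ℂ) 0 =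
        (1 + z) / 2 := by
      simp only [Pi.sub_apply, Pi.smul_apply, basisVec, Pi.single_eq_same, balancedVec, if_true,
        smul_eq_mul, mul_assoc, ← Complex.ofReal_mul, hs]
      push_cast
      ring
    rw [this]
    refine le_trans (le_of_eq ?_) h₀
    rw [Complex.sq_norm, Complex.normSq_apply]
    simp only [Complex.div_ofNat_re, Complex.div_ofNat_im, Complex.add_re, Complex.add_im,
      Complex.one_re, Complex.one_im]
    linear_combination (1 / 4) * hz2
  · have hd : 2 ≤ d := by
      have := k.2
      have : k.val ≠ 0 := fun h => hk (Fin.ext (by simpa using h))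
      omega
    have hd' : (0 : ℝ) < d - 1 := by
      have : (2 : ℝ) ≤ d := by exact_mod_cast hd
      linarith
    have h2 : (basisVec 0 - ((1 - z) * (√(1 / 2) : ℝ)) • balancedVec d : Fin d → ℂ) k =
        - ((√(1 / 2) * √(1 / (2 * (d - 1))) : ℝ) * (1 - z)) := by
      simp only [Pi.sub_apply, Pi.smul_apply, basisVec, Pi.single_eq_of_ne hk, balancedVec,
        if_neg hk, smul_eq_mul]
      push_cast
      ring
    rw [h2, norm_neg, norm_mul, mul_pow, Complex.norm_real, Real.norm_of_nonneg (by positivity),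
      mul_pow, Real.sq_sqrt (by norm_num), Real.sq_sqrt (by positivity), Complex.sq_norm,
      Complex.normSq_apply]
    simp only [Complex.sub_re, Complex.sub_im, Complex.one_re, Complex.one_im]
    have h3 : (1 - z.re) * (1 - z.re) + (0 - z.im) * (0 - z.im) = 4 * ((1 - z.re) / 2) := by
      linear_combination hz2
    rw [h3]
    calc _ = (1 - z.re) / 2 / (d - 1) := by field_simp; norm_num
      _ ≤ _ := by rw [div_le_iff₀ hd']; linarith

theorem exists_norm_eq_one_re_eq {x : ℝ} (h₁ : -1 ≤ x) (h₂ : x ≤ 1) :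
    ∃ z : ℂ, ‖z‖ = 1 ∧ z.re = x :=
  ⟨Complex.exp (Real.arccos x * Complex.I), Complex.norm_exp_ofReal_mul_I _, by
    rw [Complex.exp_ofReal_mul_I_re, Real.cos_arccos h₁ h₂]⟩

end BalancedVector

/-! ### Lower bound for testing, uniform in the error -/

namespace Protocol

variable {d : ℕ} [NeZero d]

/-- If a test of coherence at threshold `ε` reports "incoherent" on the identity within `N` queries
with probability at least `1 / 2`, then `N` is bounded below by Chebyshev's growth bound. -/
theorem TestsCoherence.one_le_mul_exp {P : Protocol d} {ε δ τ : ℝ} (hP : P.TestsCoherence ε δ)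
    (hδ : 0 < δ) (hδ1 : δ < 1) (hτ : τ < 1) (hε : 0 < ε) (hετ : ε ≤ τ * (1 - 1 / (d : ℝ)))
    {n N : ℕ} (h : 1 / 2 ≤ P.truncatedProb (oracle 1) .incoherent n N P.start P.initial) :
    1 ≤ 2 * δ * Real.exp (N * (2 * √ε / √(1 - τ))) := by
  have hd : 2 ≤ d := by
    by_contra hd
    have hd1 : d = 1 := by have := NeZero.pos d; omega
    subst hd1
    simp at hετ
    linarith
  have hd' : (2 : ℝ) ≤ d := by exact_mod_cast hd
  have hdε : d * ε ≤ τ * (d - 1) := by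
    have := mul_le_mul_of_nonneg_left hετ (by linarith : (0 : ℝ) ≤ d)
    field_simp at this
    linarith
  have hετ' : ε ≤ τ := by nlinarith
  -- The largest admissible value of (1 − Re z)/2; the state is coherent enough for Re z in [1 − 2b,
  -- 1 − 2ε].
  set b : ℝ := min 1 ((d - 1) * (1 - ε)) with hb
  -- Half the length of that interval. Keeping ε a factor τ below the maximal coherence prevents the
  -- interval from degenerating, uniformly in d.
  have hbε : 1 - τ ≤ b - ε := by
    rcases min_choice (1 : ℝ) ((d - 1) * (1 - ε)) with hm | hm <;> rw [hb, hm]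
    · linarith
    · nlinarith
  have huu : star (balancedVec d) ⬝ᵥ balancedVec d = 1 := by
    rw [← sqNorm_eq_dotProduct, sqNorm_balancedVec hd]; simp
  obtain ⟨q, hq, hqz⟩ := P.exists_truncatedProb_add_eq_eval (balancedVec d) .incoherent n N 0 0
    P.start (fun i => Polynomial.C (P.initial i)) (fun i => (Polynomial.natDegree_C _).le)
  simp only [pow_zero, one_smul, Polynomial.eval_C, zero_add] at hq hqz
  have hsmall : ∀ z : ℂ, ‖z‖ = 1 → (1 + z.re) / 2 ≤ 1 - ε → (1 - z.re) / 2 ≤ (d - 1) * (1 - ε) →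
      P.truncatedProb (phaseOracle (balancedVec d) z) .incoherent n N P.start P.initial ≤ δ := by
    intro z hz h₀ h₁
    let U : Matrix.unitaryGroup (Fin d) ℂ := ⟨_, phaseRotation_mem_unitaryGroup huu hz⟩
    have h2 := P.ofReal_truncatedProb_le U .incoherent n N P.start P.initial
    have h3 : P.verdictProbIn U .incoherent n P.start P.initial ≤ P.verdictProb U .incoherent :=
      le_iSup (fun n => P.verdictProbIn U .incoherent n P.start P.initial) n
    have h4 := hP.2 U (le_geometricCoherence_phaseRotation hz h₀ h₁)
    have h5 := P.verdictProb_add_le U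
    have h6 : ENNReal.ofReal (1 - δ) + P.verdictProb U .incoherent ≤ 1 := by
      refine le_trans ?_ h5
      gcongr
    have h7 : P.verdictProb U .incoherent ≤ ENNReal.ofReal δ := by
      have h8 : (1 : ℝ≥0∞) = ENNReal.ofReal (1 - δ) + ENNReal.ofReal δ := by
        rw [← ENNReal.ofReal_add (by linarith) hδ.le]; simp
      rw [h8] at h6
      exact (ENNReal.add_le_add_iff_left ENNReal.ofReal_ne_top).1 h6
    rw [← oracle_phaseRotation (phaseRotation_mem_unitaryGroup huu hz)]
    exact (ENNReal.ofReal_le_ofReal_iff hδ.le).1 (h2.trans (h3.trans h7))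
  have hbound : ∀ t ∈ Set.Icc (1 - 2 * b) (1 - 2 * ε), |q.eval t| ≤ 2 * δ := by
    rintro t ⟨ht1, ht2⟩
    have hb1 : b ≤ 1 := min_le_left _ _
    have hb2 : b ≤ (d - 1) * (1 - ε) := min_le_right _ _
    obtain ⟨z, hz, rfl⟩ := exists_norm_eq_one_re_eq (x := t) (by linarith) (by linarith)
    have hre : (star z).re = z.re := by simp
    rw [← hqz z hz, abs_of_nonneg (add_nonneg (P.truncatedProb_nonneg _ _ _ _ _ _)
      (P.truncatedProb_nonneg _ _ _ _ _ _))]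
    have h1 := hsmall z hz (by linarith) (by linarith)
    have h2 := hsmall (star z) (by simpa using hz) (by rw [hre]; linarith)
      (by rw [hre]; linarith)
    linarith
  -- At z = 1 both summands come from the identity, which prepares the incoherent |0⟩.
  have hone : q.eval 1 = 2 * P.truncatedProb (oracle 1) .incoherent n N P.start P.initial := by
    have h1 := hqz 1 (by simp)
    have h2 : oracle (w := P.work + 1) (1 : Matrix.unitaryGroup (Fin d) ℂ) =
        phaseOracle (balancedVec d) 1 := by
      rw [← oracle_phaseRotation (phaseRotation_mem_unitaryGroup huu (by simp))]
      congr 1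
      exact Subtype.ext (phaseRotation_one _).symm
    rw [h2, ← Complex.one_re, ← h1, star_one]
    ring
  have key := Polynomial.eval_le_mul_exp hq (l := 1 - 2 * b) (r := 1 - 2 * ε) (x := 1)
    (M := 2 * δ) (by linarith) (by linarith) (by linarith) hbound
  have h1 : 1 ≤ q.eval 1 := by rw [hone]; linarith
  refine h1.trans (key.trans ?_)
  gcongr
  have h2 : 2 * √ε / √(1 - τ) = √(4 * (ε / (1 - τ))) := by
    rw [Real.sqrt_mul (by norm_num), Real.sqrt_div hε.le, show (4 : ℝ) = 2 ^ 2 by norm_num,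
      Real.sqrt_sq (by norm_num)]
    ring
  rw [h2]
  apply Real.sqrt_le_sqrt
  calc 4 * (1 - (1 - 2 * ε)) / (1 - 2 * ε - (1 - 2 * b)) = 4 * (ε / (b - ε)) := by
        have : b - ε ≠ 0 := by linarith
        have : (1 - 2 * ε - (1 - 2 * b)) = 2 * (b - ε) := by ring
        rw [this]; field_simp; ring
    _ ≤ _ := by
      have : 0 < 1 - τ := by linarith
      gcongr

theorem isIncoherent_preparedState_one :
    IsIncoherent (preparedState (1 : Matrix.unitaryGroup (Fin d) ℂ)) :=
  ⟨0, 1, by simp, by simp [preparedState]⟩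

/-- Testing coherence at threshold `ε` takes `Ω(ε ^ (-1/2) log δ⁻¹)` queries on average when the
unknown unitary is the identity. -/
theorem TestsCoherence.ofReal_le_expectedQueries {P : Protocol d} {ε δ δ₀ τ : ℝ}
    (hP : P.TestsCoherence ε δ) (hδ : 0 < δ) (hδδ₀ : δ ≤ δ₀) (hδ₀ : δ₀ < 1 / 2) (hτ : τ < 1)
    (hε : 0 < ε) (hετ : ε ≤ τ * (1 - 1 / (d : ℝ))) :
    ENNReal.ofReal ((1 - 2 * δ₀) / 8 * (1 - Real.log 2 / Real.log δ₀⁻¹) * √(1 - τ) *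
      (Real.log δ⁻¹ / √ε)) ≤ P.expectedQueries 1 := by
  rcases eq_or_ne (P.expectedQueries 1) ∞ with htop | htop
  · rw [htop]; exact le_top
  set T := (P.expectedQueries 1).toReal with hT
  have hT0 : 0 ≤ T := ENNReal.toReal_nonneg
  set η := (1 - 2 * δ₀) / 4 with hη
  have hη0 : 0 < η := by rw [hη]; linarith
  set N := ⌊T / η⌋₊ with hN
  have hN1 : T ≤ η * (N + 1) := by
    have := (Nat.lt_floor_add_one (T / η)).le
    rw [div_le_iff₀ hη0] at this; linarith
  have hN2 : N * η ≤ T := by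
    have := Nat.floor_le (div_nonneg hT0 hη0.le)
    rwa [le_div_iff₀ hη0] at this
  obtain ⟨n, hn⟩ := P.exists_le_truncatedProb 1 .incoherent (p := 1 - δ - η) (η := η) N
    (lt_of_lt_of_le ((ENNReal.ofReal_lt_ofReal_iff (by linarith)).2 (by linarith))
      (hP.1 1 isIncoherent_preparedState_one)) hη0.le
    (by rw [← ENNReal.ofReal_toReal htop]; exact ENNReal.ofReal_le_ofReal hN1)
  have h1 := hP.one_le_mul_exp hδ (by linarith) hτ hε hετ (n := n) (N := N) (by linarith)
  have h2 : Real.log δ⁻¹ - Real.log 2 ≤ N * (2 * √ε / √(1 - τ)) := by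
    have := Real.log_le_log one_pos h1
    rw [Real.log_one, Real.log_mul (by positivity) (by positivity), Real.log_exp,
      Real.log_mul (by norm_num) hδ.ne'] at this
    rw [Real.log_inv]; linarith
  have hδ₀0 : 0 < δ₀ := by linarith
  have hlog : Real.log δ₀⁻¹ ≤ Real.log δ⁻¹ := by gcongr
  have hlog0 : 0 < Real.log δ₀⁻¹ := Real.log_pos (by
    rw [one_lt_inv₀ hδ₀0]; linarith)
  -- The factor 2 in 2δ costs log 2. As δ ≤ δ₀ < 1/2, this is at most a fixed fraction of log δ⁻¹,
  -- smaller than 1.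
  have h3 : (1 - Real.log 2 / Real.log δ₀⁻¹) * Real.log δ⁻¹ ≤ Real.log δ⁻¹ - Real.log 2 := by
    have h4 : Real.log 2 ≤ Real.log 2 / Real.log δ₀⁻¹ * Real.log δ⁻¹ := by
      have := Real.log_nonneg (by norm_num : (1 : ℝ) ≤ 2)
      rw [div_mul_eq_mul_div, le_div_iff₀ hlog0]
      gcongr
    linarith
  have hsε : 0 < √ε := Real.sqrt_pos.2 hε
  have hsτ : 0 < √(1 - τ) := Real.sqrt_pos.2 (by linarith)
  rw [← ENNReal.ofReal_toReal htop]
  refine ENNReal.ofReal_le_ofReal ?_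
  calc _ = η / 2 * √(1 - τ) / √ε * ((1 - Real.log 2 / Real.log δ₀⁻¹) * Real.log δ⁻¹) := by
        rw [hη]; ring
    _ ≤ η / 2 * √(1 - τ) / √ε * (N * (2 * √ε / √(1 - τ))) := by
        exact mul_le_mul_of_nonneg_left (h3.trans h2) (by positivity)
    _ = N * η := by field_simp
    _ ≤ T := hN2

end Protocol

/-! ### Backward recursion for runs -/

namespace Protocol

variable {d : ℕ}

/-- One step of the backward recursion for the expected reward of a run that earns `r b` for the
verdict `b` and `q` for each query, where `F` values the situation after the step. -/
noncomputable def stepValue (P : Protocol d) (U : Matrix.unitaryGroup (Fin d) ℂ)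
    (r : Verdict → ℝ≥0∞) (q : ℝ≥0∞) (F : P.Mem → (Fin d × Fin (P.work + 1) → ℂ) → ℝ≥0∞)
    (s : P.Mem) (v : Fin d × Fin (P.work + 1) → ℂ) : ℝ≥0∞ :=
  match P.action s with
  | .halt b => r b * weight v
  | .query inverse s' => q * weight v + F s' (oracle U inverse *ᵥ v)
  | .process _ K _ next => ∑ o, F (next o) (K o *ᵥ v)

variable (P : Protocol d) (U : Matrix.unitaryGroup (Fin d) ℂ)

theorem stepValue_of_halt {r : Verdict → ℝ≥0∞} {q : ℝ≥0∞}
    {F : P.Mem → (Fin d × Fin (P.work + 1) → ℂ) → ℝ≥0∞} {s : P.Mem} {b : Verdict}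
    (h : P.action s = .halt b) (v : Fin d × Fin (P.work + 1) → ℂ) :
    P.stepValue U r q F s v = r b * weight v := by simp only [stepValue, h]

theorem stepValue_of_query {r : Verdict → ℝ≥0∞} {q : ℝ≥0∞}
    {F : P.Mem → (Fin d × Fin (P.work + 1) → ℂ) → ℝ≥0∞} {s s' : P.Mem} {inverse : Bool}
    (h : P.action s = .query inverse s') (v : Fin d × Fin (P.work + 1) → ℂ) :
    P.stepValue U r q F s v = q * weight v + F s' (oracle U inverse *ᵥ v) := by
  simp only [stepValue, h]

theorem stepValue_of_process {r : Verdict → ℝ≥0∞} {q : ℝ≥0∞}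
    {F : P.Mem → (Fin d × Fin (P.work + 1) → ℂ) → ℝ≥0∞} {s : P.Mem} {m : ℕ}
    {K : Fin m → Matrix (Fin d × Fin (P.work + 1)) (Fin d × Fin (P.work + 1)) ℂ}
    {hK : ∑ o, (K o)ᴴ * K o = 1} {next : Fin m → P.Mem}
    (h : P.action s = .process m K hK next) (v : Fin d × Fin (P.work + 1) → ℂ) :
    P.stepValue U r q F s v = ∑ o, F (next o) (K o *ᵥ v) := by
  simp only [stepValue, h]

theorem verdictProbIn_succ_eq_stepValue (b : Verdict) (n : ℕ) :
    P.verdictProbIn U b (n + 1) =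
      P.stepValue U (fun b' => if b' = b then 1 else 0) 0 (P.verdictProbIn U b n) := by
  funext s v
  simp only [verdictProbIn, stepValue]
  cases P.action s <;> simp

theorem expectedQueriesIn_succ_eq_stepValue (n : ℕ) :
    P.expectedQueriesIn U (n + 1) =
      P.stepValue U (fun _ => 0) 1 (P.expectedQueriesIn U n) := by
  funext s v
  simp only [expectedQueriesIn, stepValue]
  cases P.action s <;> simp

/-- Monotonicity in the horizon allows the same n on both sides. A chain of steps can then be
followed with one fixed value function, without counting steps. -/
theorem verdictProbIn_le_stepValue (b : Verdict) (n : ℕ) (s : P.Mem)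
    (v : Fin d × Fin (P.work + 1) → ℂ) : P.verdictProbIn U b n s v ≤
      P.stepValue U (fun b' => if b' = b then 1 else 0) 0 (P.verdictProbIn U b n) s v := by
  rw [← verdictProbIn_succ_eq_stepValue]
  exact P.verdictProbIn_le_succ U b n s v

theorem expectedQueriesIn_le_stepValue (n : ℕ) (s : P.Mem)
    (v : Fin d × Fin (P.work + 1) → ℂ) : P.expectedQueriesIn U n s v ≤
      P.stepValue U (fun _ => 0) 1 (P.expectedQueriesIn U n) s v := by
  rw [← expectedQueriesIn_succ_eq_stepValue]
  exact P.expectedQueriesIn_le_succ U n s v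

/-- The probability that the protocol ever announces `b`, started in a given situation. -/
noncomputable def verdictProbFrom (b : Verdict) (s : P.Mem)
    (v : Fin d × Fin (P.work + 1) → ℂ) : ℝ≥0∞ :=
  ⨆ n, P.verdictProbIn U b n s v

theorem verdictProbFrom_smul (b : Verdict) (c : ℂ) (s : P.Mem)
    (v : Fin d × Fin (P.work + 1) → ℂ) :
    P.verdictProbFrom U b s (c • v) = ‖c‖ₑ ^ 2 * P.verdictProbFrom U b s v := by
  simp only [verdictProbFrom, verdictProbIn_smul, ENNReal.mul_iSup]

/-- Finite sums commute with monotone suprema. This direction serves lower bounds on verdict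
probabilities; upper bounds use the finite horizon. -/
theorem stepValue_le_verdictProbFrom (b : Verdict) (s : P.Mem)
    (v : Fin d × Fin (P.work + 1) → ℂ) :
    P.stepValue U (fun b' => if b' = b then 1 else 0) 0 (P.verdictProbFrom U b) s v ≤
      P.verdictProbFrom U b s v := by
  have h : ∀ n, P.verdictProbIn U b (n + 1) s v ≤ P.verdictProbFrom U b s v := fun n =>
    le_iSup (fun n => P.verdictProbIn U b n s v) (n + 1)
  simp only [verdictProbIn_succ_eq_stepValue, stepValue] at h
  unfold stepValue
  cases hs : P.action s with
  | halt b' => simp only [hs] at h; exact h 0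
  | query inv s' => simp only [hs, zero_mul, zero_add] at h ⊢; exact iSup_le h
  | process m K hK next =>
    simp only [hs] at h ⊢
    unfold verdictProbFrom at h ⊢
    rw [ENNReal.finsetSum_iSup_of_monotone fun o => P.verdictProbIn_monotone U b _ _]
    exact iSup_le h

end Protocol

/-! ### The amplitude amplification protocol -/

/-- The classical memory of the amplitude amplification protocol. Here `k` is the outcome of the
first measurement, `J` the number of stages begun, `L` the list of attempts left in the
current stage, and `t` the number of Grover iterations left in the current attempt. -/
inductive GroverMem (d : ℕ) : Type
  | start
  | readout
  | attempt (k : Fin d) (J : ℕ) (L : List ℕ)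
  | rotate (k : Fin d) (J : ℕ) (L : List ℕ) (t : ℕ)
  | unprepare (k : Fin d) (J : ℕ) (L : List ℕ) (t : ℕ)
  | reflect (k : Fin d) (J : ℕ) (L : List ℕ) (t : ℕ)
  | reprepare (k : Fin d) (J : ℕ) (L : List ℕ) (t : ℕ)
  | found

namespace GroverProtocol

open Protocol

variable {d : ℕ}

theorem star_dotProduct_basisVec (k : Fin d) : star (basisVec k) ⬝ᵥ basisVec k = 1 := by
  rw [star_basisVec_dotProduct, basisVec, Pi.single_eq_same]

/-- The reflection about the complement of `|k⟩`, acting on system and workspace. -/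
def reflection {w : ℕ} (k : Fin d) : Matrix (Fin d × Fin w) (Fin d × Fin w) ℂ :=
  phaseRotation (basisVec k) (-1) ⊗ₖ 1

theorem reflection_complete {w : ℕ} (k : Fin d) :
    ∑ _ : Fin 1, (reflection (w := w) k)ᴴ * reflection k = 1 := by
  rw [Finset.sum_const, Finset.card_univ, Fintype.card_fin, one_smul, reflection,
    Matrix.conjTranspose_kronecker, ← Matrix.mul_kronecker_mul,
    phaseRotation_conjTranspose_mul_self (star_dotProduct_basisVec k) (by simp)]
  simp

theorem one_complete {ι : Type} [Fintype ι] [DecidableEq ι] :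
    ∑ _ : Fin 1, (1 : Matrix ι ι ℂ)ᴴ * 1 = 1 := by simp

variable [NeZero d]

/-- Measuring the system in the incoherent basis and resetting it to `|0⟩`. -/
def readout {w : ℕ} (o : Fin d) : Matrix (Fin d × Fin w) (Fin d × Fin w) ℂ :=
  Matrix.single 0 o 1 ⊗ₖ 1

theorem readout_complete {w : ℕ} : ∑ o : Fin d, (readout (w := w) o)ᴴ * readout o = 1 := by
  simp only [readout, Matrix.conjTranspose_kronecker, ← Matrix.mul_kronecker_mul,
    Matrix.conjTranspose_single, Matrix.single_mul_single_same, Matrix.conjTranspose_one, mul_one,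
    star_one]
  ext ⟨i, j⟩ ⟨i', j'⟩
  simp only [Matrix.sum_apply, Matrix.kroneckerMap_apply, Matrix.single_apply, Matrix.one_apply,
    Prod.mk.injEq, ite_and]
  split_ifs <;> simp_all

end GroverProtocol

open GroverProtocol in
/-- Amplitude amplification. The protocol first measures `ψ`, with outcome `k`, and then makes
attempts at finding another outcome. An attempt `j` amplifies the part of `ψ` orthogonal to `|k⟩`
with `3 ^ j` queries. The attempts are grouped into stages, and the protocol gives up when there
are no more stages. -/
noncomputable def groverProtocol (d : ℕ) [NeZero d] (stages : ℕ → Option (List ℕ)) :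
    Protocol d where
  work := 0
  Mem := GroverMem d
  start := .start
  action
    | .start => .query false .readout
    | .readout => .process d readout readout_complete fun o => .attempt o 0 []
    | .attempt k J [] =>
      match stages J with
      | none => .halt .incoherent
      -- The identity process serves as a pure change of memory.
      | some L => .process 1 (fun _ => 1) one_complete fun _ => .attempt k (J + 1) L
    -- The first query prepares ψ and each iteration takes two more, for a total of 3 ^ j.
    | .attempt k J (j :: L) => .query false (.rotate k J L ((3 ^ j - 1) / 2))
    | .rotate k J L 0 =>
      .process d readout readout_complete fun o => if o = k then .attempt k J L else .found
    | .rotate k J L (t + 1) =>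
      .process 1 (fun _ => reflection k) (reflection_complete k) fun _ => .unprepare k J L t
    | .unprepare k J L t => .query true (.reflect k J L t)
    | .reflect k J L t =>
      .process 1 (fun _ => reflection 0) (reflection_complete 0) fun _ => .reprepare k J L t
    | .reprepare k J L t => .query false (.rotate k J L t)
    | .found => .halt .coherent

/-! ### Grover iterations as plane rotations -/

namespace GroverProtocol

open Protocol

variable {d : ℕ}

/-- A state of the system, seen as a state of system and trivial workspace. -/
def withWorkspace (x : Fin d → ℂ) : Fin d × Fin (0 + 1) → ℂ := fun i => x i.1

theorem weight_withWorkspace (x : Fin d → ℂ) : weight (withWorkspace x) = weight x := by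
  simp [weight, withWorkspace, Fintype.sum_prod_type]

theorem kronecker_mulVec_withWorkspace (A : Matrix (Fin d) (Fin d) ℂ) (x : Fin d → ℂ) :
    (A ⊗ₖ (1 : Matrix (Fin (0 + 1)) (Fin (0 + 1)) ℂ)) *ᵥ withWorkspace x =
      withWorkspace (A *ᵥ x) := by
  ext ⟨i, j⟩
  exact kronecker_one_mulVec A _ i j

/-- The Grover iteration for the state `ψ` and the basis vector `|k⟩`. -/
def groverIteration (ψ : Fin d → ℂ) (k : Fin d) : Matrix (Fin d) (Fin d) ℂ :=
  phaseRotation ψ (-1) * phaseRotation (basisVec k) (-1)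

theorem sqNorm_groverIteration_pow {ψ : Fin d → ℂ} (hψ : sqNorm ψ = 1) (k : Fin d) (t : ℕ)
    (x : Fin d → ℂ) : sqNorm (groverIteration ψ k ^ t *ᵥ x) = sqNorm x := by
  have hψψ : star ψ ⬝ᵥ ψ = 1 := by rw [← sqNorm_eq_dotProduct, hψ]; simp
  induction t with
  | zero => simp
  | succ t ih =>
    rw [pow_succ', ← Matrix.mulVec_mulVec, groverIteration, ← Matrix.mulVec_mulVec,
      sqNorm_mulVec_of_conjTranspose_mul_self _
        (phaseRotation_conjTranspose_mul_self hψψ (by simp)),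
      sqNorm_mulVec_of_conjTranspose_mul_self _
        (phaseRotation_conjTranspose_mul_self (star_dotProduct_basisVec k) (by simp))]
    exact ih

/-- The angle between `ψ` and `|k⟩`. -/
noncomputable def angle (ψ : Fin d → ℂ) (k : Fin d) : ℝ := Real.arccos ‖ψ k‖

theorem norm_sq_le_one {ψ : Fin d → ℂ} (hψ : sqNorm ψ = 1) (k : Fin d) : ‖ψ k‖ ^ 2 ≤ 1 :=
  (Finset.single_le_sum (f := fun i => ‖ψ i‖ ^ 2) (fun _ _ => by positivity)
    (Finset.mem_univ k)).trans hψ.le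

theorem cos_angle {ψ : Fin d → ℂ} (hψ : sqNorm ψ = 1) (k : Fin d) :
    Real.cos (angle ψ k) = ‖ψ k‖ := by
  have h := norm_sq_le_one hψ k
  exact Real.cos_arccos (by linarith [norm_nonneg (ψ k)]) (by nlinarith [norm_nonneg (ψ k)])

/-- Two reflections compose to a rotation by 2θ in the plane of |k⟩ and ψ. The coefficients α and β
multiply the parts of ψ along |k⟩ and orthogonal to it; leaving these parts unnormalized avoids
division by cos θ or sin θ, either of which may vanish. -/
theorem exists_groverIteration_pow_eq {ψ : Fin d → ℂ} (hψ : sqNorm ψ = 1) (k : Fin d) (t : ℕ) :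
    ∃ α β : ℝ, groverIteration ψ k ^ t *ᵥ ψ =
        (α * ψ k - β * ψ k) • basisVec k + (β : ℂ) • ψ ∧
      Real.cos (angle ψ k) * α = Real.cos ((2 * t + 1) * angle ψ k) ∧
      Real.sin (angle ψ k) * β = Real.sin ((2 * t + 1) * angle ψ k) := by
  have hψψ : star ψ ⬝ᵥ ψ = 1 := by rw [← sqNorm_eq_dotProduct, hψ]; simp
  have hkψ : star (basisVec k) ⬝ᵥ ψ = ψ k := star_basisVec_dotProduct k ψ
  have hψk : star ψ ⬝ᵥ basisVec k = star (ψ k) := by rw [Matrix.star_dotProduct, hkψ]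
  have hkk := star_dotProduct_basisVec k
  set θ := angle ψ k with hθ
  have hC := cos_angle hψ k
  rw [← hθ] at hC
  have hSC := Real.sin_sq_add_cos_sq θ
  have hCC : star (ψ k) * ψ k = (Real.cos θ : ℂ) ^ 2 := by
    rw [hC]; exact Complex.conj_mul' (ψ k)
  have hSC' : (Real.sin θ : ℂ) ^ 2 + (Real.cos θ : ℂ) ^ 2 = 1 := by exact_mod_cast hSC
  induction t with
  | zero => exact ⟨1, 1, by simp, by simp, by simp⟩
  | succ t ih =>
    obtain ⟨α, β, hx, hα, hβ⟩ := ih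
    refine ⟨(2 * Real.cos θ ^ 2 - 1) * α - 2 * Real.sin θ ^ 2 * β,
      2 * Real.cos θ ^ 2 * α + (1 - 2 * Real.sin θ ^ 2) * β, ?_, ?_, ?_⟩
    · rw [pow_succ', ← Matrix.mulVec_mulVec, hx, groverIteration, ← Matrix.mulVec_mulVec]
      simp only [phaseRotation_mulVec, dotProduct_add, dotProduct_sub, dotProduct_smul, hψψ, hkψ,
        hψk, hkk, smul_eq_mul]
      push_cast
      have e1 : (1 - -1 : ℂ) = 2 := by norm_num
      push_cast at hCC hSC'
      rw [e1]
      ext i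
      simp only [Pi.sub_apply, Pi.add_apply, Pi.smul_apply, smul_eq_mul]
      linear_combination 2 * ψ i * (α + β) * hCC + 2 * ψ i * β * hSC'
    · have : (2 * ((t + 1 : ℕ) : ℝ) + 1) * θ = 2 * θ + (2 * t + 1) * θ := by push_cast; ring
      rw [this, Real.cos_add, ← hα, ← hβ, Real.cos_two_mul, Real.sin_two_mul]
      ring
    · have : (2 * ((t + 1 : ℕ) : ℝ) + 1) * θ = 2 * θ + (2 * t + 1) * θ := by push_cast; ring
      rw [this, Real.sin_add, ← hα, ← hβ, Real.cos_two_mul', Real.sin_two_mul]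
      linear_combination - Real.sin θ * β * hSC

theorem norm_sq_groverIteration_pow {ψ : Fin d → ℂ} (hψ : sqNorm ψ = 1) (k : Fin d) (t : ℕ) :
    ‖(groverIteration ψ k ^ t *ᵥ ψ) k‖ ^ 2 = Real.cos ((2 * t + 1) * angle ψ k) ^ 2 := by
  obtain ⟨α, β, hx, hα, -⟩ := exists_groverIteration_pow_eq hψ k t
  have : (groverIteration ψ k ^ t *ᵥ ψ) k = α * ψ k := by
    rw [hx]; simp [basisVec]
  rw [this, ← hα, cos_angle hψ, norm_mul, Complex.norm_real, mul_pow, mul_pow, Real.norm_eq_abs,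
    sq_abs, mul_comm]

variable [NeZero d]

theorem readout_mulVec (o : Fin d) (x : Fin d → ℂ) :
    readout o *ᵥ withWorkspace x = x o • withWorkspace (basisVec 0) := by
  rw [readout, kronecker_mulVec_withWorkspace]
  ext i
  simp [withWorkspace, basisVec, Pi.single_apply, Matrix.mulVec, dotProduct, Matrix.single_apply,
    ite_and, eq_comm]

theorem initial_eq (stages : ℕ → Option (List ℕ)) :
    (groverProtocol d stages).initial = withWorkspace (basisVec 0) := by
  ext ⟨i, j⟩
  have : j = 0 := Subsingleton.elim (α := Fin 1) _ _
  subst this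
  simp [Protocol.initial, withWorkspace, basisVec, Pi.single_apply, Prod.ext_iff]

/-- Conjugation by U carries the reflection in |0⟩ to the reflection in U|0⟩ = ψ. This is where the
inverse queries are needed. -/
theorem oracle_mul_phaseRotation_mul (U : Matrix.unitaryGroup (Fin d) ℂ) (k : Fin d) :
    (U : Matrix (Fin d) (Fin d) ℂ) * phaseRotation (basisVec 0) (-1) *
      (U : Matrix (Fin d) (Fin d) ℂ)ᴴ * phaseRotation (basisVec k) (-1) =
        groverIteration (preparedState U) k := by
  have h : (U : Matrix (Fin d) (Fin d) ℂ) * (U : Matrix (Fin d) (Fin d) ℂ)ᴴ = 1 :=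
    Matrix.mem_unitaryGroup_iff.1 U.2
  rw [groverIteration]
  congr 1
  simp only [phaseRotation, mul_sub, sub_mul, mul_one, h, preparedState, mul_smul_comm,
    smul_mul_assoc, Matrix.mul_vecMulVec, Matrix.vecMulVec_mul, Matrix.star_mulVec]

end GroverProtocol

/-! ### Upper and lower estimates by a common argument -/

/-- A preorder on the extended nonnegative reals, such as `≤` or `≥`, that is preserved by
affine maps. -/
structure IsAffinePreorder (R : ℝ≥0∞ → ℝ≥0∞ → Prop) : Prop where
  refl : ∀ x, R x x
  trans : ∀ {x y z}, R x y → R y z → R x z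
  affine : ∀ {x y} (a b : ℝ≥0∞), R x y → R (a + b * x) (a + b * y)

theorem isAffinePreorder_le : IsAffinePreorder (· ≤ ·) :=
  ⟨fun _ => le_rfl, fun h h' => h.trans h', fun _ _ h => by gcongr⟩

theorem isAffinePreorder_ge : IsAffinePreorder (· ≥ ·) :=
  ⟨fun _ => le_rfl, fun h h' => h'.trans h, fun _ _ h => by
    show _ ≤ _
    gcongr⟩

namespace GroverProtocol

open Protocol

variable {d : ℕ} {stages : ℕ → Option (List ℕ)} {U : Matrix.unitaryGroup (Fin d) ℂ}
  {r : Verdict → ℝ≥0∞} {q : ℝ≥0∞} {F : GroverMem d → (Fin d × Fin (0 + 1) → ℂ) → ℝ≥0∞}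
  {R : ℝ≥0∞ → ℝ≥0∞ → Prop}

/-- The probability that attempt `j` after the outcome `k` fails. -/
noncomputable def miss (ψ : Fin d → ℂ) (k : Fin d) (j : ℕ) : ℝ :=
  Real.cos (3 ^ j * angle ψ k) ^ 2

/-- The probability that all attempts of a list fail. -/
noncomputable def missAll (ψ : Fin d → ℂ) (k : Fin d) (L : List ℕ) : ℝ :=
  (L.map (miss ψ k)).prod

/-- The number of queries of a list of attempts. -/
def cost (L : List ℕ) : ℕ := (L.map (3 ^ ·)).sum

theorem miss_nonneg (ψ : Fin d → ℂ) (k : Fin d) (j : ℕ) : 0 ≤ miss ψ k j := sq_nonneg _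

theorem miss_le_one (ψ : Fin d → ℂ) (k : Fin d) (j : ℕ) : miss ψ k j ≤ 1 := Real.cos_sq_le_one _

theorem missAll_nonneg (ψ : Fin d → ℂ) (k : Fin d) (L : List ℕ) : 0 ≤ missAll ψ k L :=
  List.prod_nonneg fun x hx => by
    obtain ⟨j, -, rfl⟩ := List.mem_map.1 hx
    exact miss_nonneg ψ k j

theorem missAll_cons (ψ : Fin d → ℂ) (k : Fin d) (j : ℕ) (L : List ℕ) :
    missAll ψ k (j :: L) = miss ψ k j * missAll ψ k L := by simp [missAll]

theorem missAll_le_one (ψ : Fin d → ℂ) (k : Fin d) (L : List ℕ) : missAll ψ k L ≤ 1 := by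
  induction L with
  | nil => simp [missAll]
  | cons j L ih =>
    rw [missAll_cons]
    exact mul_le_one₀ (miss_le_one _ _ _) (missAll_nonneg _ _ _) ih

theorem oracle_mulVec_withWorkspace (x : Fin d → ℂ) (inverse : Bool) :
    oracle U inverse *ᵥ withWorkspace x = withWorkspace
      ((if inverse then (U : Matrix (Fin d) (Fin d) ℂ)ᴴ
        else (U : Matrix (Fin d) (Fin d) ℂ)) *ᵥ x) :=
  kronecker_mulVec_withWorkspace _ x

variable [NeZero d]

theorem weight_initial_state : weight (withWorkspace (d := d) (basisVec 0)) = 1 := by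
  rw [weight_withWorkspace, weight_eq_ofReal, sqNorm_basisVec, ENNReal.ofReal_one]

theorem stepValue_query (inverse : Bool) {s s' : GroverMem d}
    (h : (groverProtocol d stages).action s = .query inverse s') {x : Fin d → ℂ}
    (hx : sqNorm x = 1) :
    (groverProtocol d stages).stepValue U r q F s (withWorkspace x) =
      q + F s' (withWorkspace ((if inverse then (U : Matrix (Fin d) (Fin d) ℂ)ᴴ
        else (U : Matrix (Fin d) (Fin d) ℂ)) *ᵥ x)) := by
  refine (stepValue_of_query _ _ h _).trans ?_
  change q * weight (withWorkspace x) + F s' (oracle U inverse *ᵥ withWorkspace x) = _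
  rw [weight_withWorkspace, weight_eq_ofReal, hx, ENNReal.ofReal_one, mul_one,
    oracle_mulVec_withWorkspace]

theorem stepValue_rotate_succ (k : Fin d) (J : ℕ) (L : List ℕ) (t : ℕ) (x : Fin d → ℂ) :
    (groverProtocol d stages).stepValue U r q F (.rotate k J L (t + 1)) (withWorkspace x) =
      F (.unprepare k J L t) (withWorkspace (phaseRotation (basisVec k) (-1) *ᵥ x)) := by
  rw [← kronecker_mulVec_withWorkspace]
  exact Fin.sum_univ_one _

theorem stepValue_reflect (k : Fin d) (J : ℕ) (L : List ℕ) (t : ℕ) (x : Fin d → ℂ) :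
    (groverProtocol d stages).stepValue U r q F (.reflect k J L t) (withWorkspace x) =
      F (.reprepare k J L t) (withWorkspace (phaseRotation (basisVec 0) (-1) *ᵥ x)) := by
  rw [← kronecker_mulVec_withWorkspace]
  exact Fin.sum_univ_one _

/-- The readout leaves a multiple of |0⟩ in every branch, and homogeneity of F turns the multiple
into the outcome probability. -/
theorem stepValue_rotate_zero (hsmul : ∀ (c : ℂ) s v, F s (c • v) = ‖c‖ₑ ^ 2 * F s v)
    (k : Fin d) (J : ℕ) (L : List ℕ) (x : Fin d → ℂ) :
    (groverProtocol d stages).stepValue U r q F (.rotate k J L 0) (withWorkspace x) =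
      ∑ o, ‖x o‖ₑ ^ 2 * F (if o = k then .attempt k J L else .found)
        (withWorkspace (basisVec 0)) := by
  change ∑ o, F (if o = k then .attempt k J L else .found) (readout o *ᵥ withWorkspace x) = _
  simp only [readout_mulVec, hsmul]

theorem stepValue_readout (hsmul : ∀ (c : ℂ) s v, F s (c • v) = ‖c‖ₑ ^ 2 * F s v)
    (x : Fin d → ℂ) :
    (groverProtocol d stages).stepValue U r q F .readout (withWorkspace x) =
      ∑ o, ‖x o‖ₑ ^ 2 * F (.attempt o 0 []) (withWorkspace (basisVec 0)) := by
  change ∑ o, F (.attempt o 0 []) (readout o *ᵥ withWorkspace x) = _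
  simp only [readout_mulVec, hsmul]

theorem stepValue_found :
    (groverProtocol d stages).stepValue U r q F .found (withWorkspace (basisVec 0)) =
      r .coherent := by
  change r .coherent * weight (withWorkspace (basisVec 0)) = _
  rw [weight_initial_state, mul_one]

theorem stepValue_attempt_nil_some (k : Fin d) (J : ℕ) {L : List ℕ} (hL : stages J = some L) :
    (groverProtocol d stages).stepValue U r q F (.attempt k J []) (withWorkspace (basisVec 0)) =
      F (.attempt k (J + 1) L) (withWorkspace (basisVec 0)) := by
  have h : (groverProtocol d stages).action (.attempt k J []) =
      .process 1 (fun _ => 1) one_complete fun _ => .attempt k (J + 1) L := by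
    simp only [groverProtocol, hL]
    rfl
  refine (stepValue_of_process _ _ h _).trans ?_
  change ∑ _ : Fin 1, F (.attempt k (J + 1) L) (1 *ᵥ withWorkspace (basisVec 0)) = _
  rw [Fin.sum_univ_one, Matrix.one_mulVec]

theorem stepValue_attempt_nil_none (k : Fin d) (J : ℕ) (hL : stages J = none) :
    (groverProtocol d stages).stepValue U r q F (.attempt k J []) (withWorkspace (basisVec 0)) =
      r .incoherent := by
  have h : (groverProtocol d stages).action (.attempt k J []) = .halt .incoherent := by
    simp only [groverProtocol, hL]
    rfl
  refine (stepValue_of_halt _ _ h _).trans ?_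
  change r .incoherent * weight (withWorkspace (basisVec 0)) = _
  rw [weight_initial_state, mul_one]

/-- One iteration passes through four memory states, two of which make a query. -/
theorem rel_rotate (hR : IsAffinePreorder R)
    (hF : ∀ s v, R (F s v) ((groverProtocol d stages).stepValue U r q F s v))
    (k : Fin d) (J : ℕ) (L : List ℕ) (t : ℕ) {x : Fin d → ℂ} (hx : sqNorm x = 1) :
    R (F (.rotate k J L t) (withWorkspace x))
      (q * (2 * t : ℕ) + F (.rotate k J L 0)
        (withWorkspace (groverIteration (preparedState U) k ^ t *ᵥ x))) := by
  induction t generalizing x with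
  | zero => simpa using hR.refl _
  | succ t ih =>
    have hA : ∀ {y : Fin d → ℂ} (A : Matrix (Fin d) (Fin d) ℂ), Aᴴ * A = 1 → sqNorm y = 1 →
        sqNorm (A *ᵥ y) = 1 := fun A h hy => by
      rw [sqNorm_mulVec_of_conjTranspose_mul_self A h, hy]
    have hU := Matrix.UnitaryGroup.star_mul_self U
    have hU' : (U : Matrix (Fin d) (Fin d) ℂ)ᴴᴴ * (U : Matrix (Fin d) (Fin d) ℂ)ᴴ = 1 := by
      rw [Matrix.conjTranspose_conjTranspose]; exact Matrix.mem_unitaryGroup_iff.1 U.2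
    have hρ : ∀ l : Fin d,
        (phaseRotation (basisVec l) (-1))ᴴ * phaseRotation (basisVec l) (-1) = 1 :=
      fun l => phaseRotation_conjTranspose_mul_self (star_dotProduct_basisVec l) (by simp)
    set x₁ := phaseRotation (basisVec k) (-1) *ᵥ x with hx₁
    set x₂ := (U : Matrix (Fin d) (Fin d) ℂ)ᴴ *ᵥ x₁ with hx₂
    set x₃ := phaseRotation (basisVec 0) (-1) *ᵥ x₂ with hx₃
    set x₄ := (U : Matrix (Fin d) (Fin d) ℂ) *ᵥ x₃ with hx₄
    have n₁ : sqNorm x₁ = 1 := hA _ (hρ k) hx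
    have n₂ : sqNorm x₂ = 1 := hA _ hU' n₁
    have n₃ : sqNorm x₃ = 1 := hA _ (hρ 0) n₂
    have n₄ : sqNorm x₄ = 1 := hA _ hU n₃
    have h₁ := hF (.rotate k J L (t + 1)) (withWorkspace x)
    have h₂ := hF (.unprepare k J L t) (withWorkspace x₁)
    have h₃ := hF (.reflect k J L t) (withWorkspace x₂)
    have h₄ := hF (.reprepare k J L t) (withWorkspace x₃)
    rw [stepValue_rotate_succ] at h₁
    rw [stepValue_query true rfl n₁, if_pos rfl] at h₂
    rw [stepValue_reflect] at h₃
    rw [stepValue_query false rfl n₃, if_neg Bool.false_ne_true] at h₄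
    have h₅ := ih n₄
    have e : groverIteration (preparedState U) k ^ (t + 1) *ᵥ x =
        groverIteration (preparedState U) k ^ t *ᵥ x₄ := by
      rw [hx₄, hx₃, hx₂, hx₁, pow_succ, ← oracle_mul_phaseRotation_mul]
      simp only [Matrix.mulVec_mulVec, mul_assoc]
    rw [e]
    have h₆ := hR.trans h₄ (by simpa using hR.affine q 1 h₅)
    have h₇ := hR.trans h₂ (by simpa using hR.affine q 1 (hR.trans h₃ h₆))
    refine hR.trans h₁ ?_
    convert h₇ using 1
    push_cast
    ring

theorem rel_readout (hR : IsAffinePreorder R)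
    (hF : ∀ s v, R (F s v) ((groverProtocol d stages).stepValue U r q F s v))
    (hsmul : ∀ (c : ℂ) s v, F s (c • v) = ‖c‖ₑ ^ 2 * F s v)
    (k : Fin d) (J : ℕ) (L : List ℕ) {y : Fin d → ℂ} (hy : sqNorm y = 1) :
    R (F (.rotate k J L 0) (withWorkspace y))
      (r .coherent * ENNReal.ofReal (1 - ‖y k‖ ^ 2) +
        ENNReal.ofReal (‖y k‖ ^ 2) * F (.attempt k J L) (withWorkspace (basisVec 0))) := by
  have h₁ := hF (.rotate k J L 0) (withWorkspace y)
  have h₂ := hF .found (withWorkspace (basisVec 0))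
  rw [stepValue_rotate_zero hsmul] at h₁
  rw [stepValue_found] at h₂
  have e : ∀ i, ‖y i‖ₑ ^ 2 = ENNReal.ofReal (‖y i‖ ^ 2) := fun i => by
    rw [← ofReal_norm, ENNReal.ofReal_pow (norm_nonneg _)]
  have h₃ : ∑ i ∈ Finset.univ.erase k, ‖y i‖ₑ ^ 2 = ENNReal.ofReal (1 - ‖y k‖ ^ 2) := by
    simp only [e]
    rw [← ENNReal.ofReal_sum_of_nonneg fun _ _ => by positivity, ← hy, sqNorm,
      ← Finset.sum_erase_add _ _ (Finset.mem_univ k), add_sub_cancel_right]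
  rw [← Finset.sum_erase_add _ _ (Finset.mem_univ k), if_pos rfl,
    Finset.sum_congr rfl fun i hi => by rw [if_neg (Finset.ne_of_mem_erase hi)],
    ← Finset.sum_mul, h₃, e, add_comm] at h₁
  refine hR.trans h₁ ?_
  rw [add_comm (r _ * _), mul_comm (r _)]
  exact hR.affine _ _ h₂

theorem rel_attempt_cons (hR : IsAffinePreorder R)
    (hF : ∀ s v, R (F s v) ((groverProtocol d stages).stepValue U r q F s v))
    (hsmul : ∀ (c : ℂ) s v, F s (c • v) = ‖c‖ₑ ^ 2 * F s v)
    (k : Fin d) (J j : ℕ) (L : List ℕ) :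
    R (F (.attempt k J (j :: L)) (withWorkspace (basisVec 0)))
      (q * (3 ^ j : ℕ) + r .coherent * ENNReal.ofReal (1 - miss (preparedState U) k j) +
        ENNReal.ofReal (miss (preparedState U) k j) *
          F (.attempt k J L) (withWorkspace (basisVec 0))) := by
  set ψ := preparedState U with hψ
  have hψ1 : sqNorm ψ = 1 := sqNorm_preparedState U
  set t := (3 ^ j - 1) / 2 with ht
  -- Odd powers of this form make 3 ^ j both the query count 1 + 2t and the angle multiplier.
  have h3 : 3 ^ j = 2 * t + 1 := by
    have h1 : 3 ^ j % 2 = 1 := Nat.odd_iff.1 (Odd.pow (by decide))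
    have h2 : 0 < 3 ^ j := by positivity
    omega
  have h₁ := hF (.attempt k J (j :: L)) (withWorkspace (basisVec 0))
  rw [stepValue_query false rfl (sqNorm_basisVec 0), if_neg Bool.false_ne_true] at h₁
  change R _ (q + F (.rotate k J L t) (withWorkspace ψ)) at h₁
  have h₂ := rel_rotate hR hF k J L t hψ1
  have h₃ := rel_readout hR hF hsmul k J L (y := groverIteration ψ k ^ t *ᵥ ψ)
    (by rw [sqNorm_groverIteration_pow hψ1, hψ1])
  have h₄ : ‖(groverIteration ψ k ^ t *ᵥ ψ) k‖ ^ 2 = miss ψ k j := by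
    rw [norm_sq_groverIteration_pow hψ1, miss]
    congr 3
    exact_mod_cast h3.symm
  rw [h₄] at h₃
  have h₅ := hR.trans h₂ (by simpa using hR.affine (q * (2 * t : ℕ)) 1 h₃)
  have h₆ := hR.trans h₁ (by simpa using hR.affine q 1 h₅)
  convert h₆ using 1
  rw [h3]
  push_cast
  ring

end GroverProtocol

/-! ### Recursion over stages -/

namespace GroverProtocol

open Protocol

section Attempts

variable {d : ℕ} [NeZero d] {stages : ℕ → Option (List ℕ)} {U : Matrix.unitaryGroup (Fin d) ℂ}
  {r : Verdict → ℝ≥0∞} {q : ℝ≥0∞} {F : GroverMem d → (Fin d × Fin (0 + 1) → ℂ) → ℝ≥0∞}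
  {R : ℝ≥0∞ → ℝ≥0∞ → Prop}

theorem rel_attempt (hR : IsAffinePreorder R)
    (hF : ∀ s v, R (F s v) ((groverProtocol d stages).stepValue U r 0 F s v))
    (hsmul : ∀ (c : ℂ) s v, F s (c • v) = ‖c‖ₑ ^ 2 * F s v) (k : Fin d) (J : ℕ) (L : List ℕ) :
    R (F (.attempt k J L) (withWorkspace (basisVec 0)))
      (r .coherent * ENNReal.ofReal (1 - missAll (preparedState U) k L) +
        ENNReal.ofReal (missAll (preparedState U) k L) *
          F (.attempt k J []) (withWorkspace (basisVec 0))) := by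
  induction L with
  | nil => simpa [missAll] using hR.refl _
  | cons j L ih =>
    have h := rel_attempt_cons hR hF hsmul k J j L
    rw [zero_mul, zero_add] at h
    refine hR.trans h ?_
    convert hR.affine (r .coherent * ENNReal.ofReal (1 - miss (preparedState U) k j))
      (ENNReal.ofReal (miss (preparedState U) k j)) ih using 1
    set m := miss (preparedState U) k j with hm
    set M := missAll (preparedState U) k L with hM
    have hm0 : 0 ≤ m := miss_nonneg _ _ _
    have hm1 : m ≤ 1 := miss_le_one _ _ _
    have hM1 : M ≤ 1 := missAll_le_one _ _ _
    rw [missAll_cons, ← hm, ← hM, show 1 - m * M = (1 - m) + m * (1 - M) by ring,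
      ENNReal.ofReal_add (by linarith) (mul_nonneg hm0 (by linarith)), ENNReal.ofReal_mul hm0,
      ENNReal.ofReal_mul hm0]
    ring

/-- The attempts within the list are charged in full, even after a success. The discount by the
failure probability is kept only for what follows the list, where it makes the series over stages
converge. -/
theorem attempt_le_cost_add
    (hF : ∀ s v, F s v ≤ (groverProtocol d stages).stepValue U (fun _ => 0) 1 F s v)
    (hsmul : ∀ (c : ℂ) s v, F s (c • v) = ‖c‖ₑ ^ 2 * F s v) (k : Fin d) (J : ℕ) (L : List ℕ) :
    F (.attempt k J L) (withWorkspace (basisVec 0)) ≤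
      cost L + ENNReal.ofReal (missAll (preparedState U) k L) *
        F (.attempt k J []) (withWorkspace (basisVec 0)) := by
  induction L with
  | nil => simp [missAll, cost]
  | cons j L ih =>
    refine (rel_attempt_cons isAffinePreorder_le hF hsmul k J j L).trans ?_
    have hm0 : 0 ≤ miss (preparedState U) k j := miss_nonneg _ _ _
    have hm1 : ENNReal.ofReal (miss (preparedState U) k j) ≤ 1 := by
      rw [ENNReal.ofReal_le_one]; exact miss_le_one _ _ _
    rw [missAll_cons, ENNReal.ofReal_mul hm0, one_mul, zero_mul, add_zero]
    calc _ ≤ ((3 ^ j : ℕ) : ℝ≥0∞) + ENNReal.ofReal (miss (preparedState U) k j) *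
          (cost L + ENNReal.ofReal (missAll (preparedState U) k L) *
            F (.attempt k J []) (withWorkspace (basisVec 0))) := by gcongr
      _ = ((3 ^ j : ℕ) : ℝ≥0∞) + (ENNReal.ofReal (miss (preparedState U) k j) * cost L +
          ENNReal.ofReal (miss (preparedState U) k j) *
            ENNReal.ofReal (missAll (preparedState U) k L) *
              F (.attempt k J []) (withWorkspace (basisVec 0))) := by ring
      _ ≤ ((3 ^ j : ℕ) : ℝ≥0∞) + (1 * cost L + ENNReal.ofReal (miss (preparedState U) k j) *
            ENNReal.ofReal (missAll (preparedState U) k L) *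
              F (.attempt k J []) (withWorkspace (basisVec 0))) := by gcongr
      _ = _ := by simp only [cost, List.map_cons, List.sum_cons]; push_cast; ring

end Attempts

section Protocol

variable {d : ℕ} [NeZero d] (stages : ℕ → Option (List ℕ)) (U : Matrix.unitaryGroup (Fin d) ℂ)

/-- The probability of the verdict `b` in a run of the protocol from a given situation. -/
noncomputable def verdictFrom (b : Verdict) :
    GroverMem d → (Fin d × Fin (0 + 1) → ℂ) → ℝ≥0∞ :=
  (groverProtocol d stages).verdictProbFrom U b

/-- The probability of the verdict `b` in the first `n` steps of a run of the protocol from a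
given situation. -/
noncomputable def verdictIn (b : Verdict) (n : ℕ) :
    GroverMem d → (Fin d × Fin (0 + 1) → ℂ) → ℝ≥0∞ :=
  (groverProtocol d stages).verdictProbIn U b n

/-- The expected number of queries in the first `n` steps of a run of the protocol from a given
situation. -/
noncomputable def queriesIn (n : ℕ) : GroverMem d → (Fin d × Fin (0 + 1) → ℂ) → ℝ≥0∞ :=
  (groverProtocol d stages).expectedQueriesIn U n

theorem verdictFrom_smul (b : Verdict) (c : ℂ) (s : GroverMem d) (v : Fin d × Fin (0 + 1) → ℂ) :
    verdictFrom stages U b s (c • v) = ‖c‖ₑ ^ 2 * verdictFrom stages U b s v :=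
  (groverProtocol d stages).verdictProbFrom_smul U b c s v

theorem verdictIn_smul (b : Verdict) (n : ℕ) (c : ℂ) (s : GroverMem d)
    (v : Fin d × Fin (0 + 1) → ℂ) :
    verdictIn stages U b n s (c • v) = ‖c‖ₑ ^ 2 * verdictIn stages U b n s v :=
  (groverProtocol d stages).verdictProbIn_smul U b c n s v

theorem queriesIn_smul (n : ℕ) (c : ℂ) (s : GroverMem d) (v : Fin d × Fin (0 + 1) → ℂ) :
    queriesIn stages U n s (c • v) = ‖c‖ₑ ^ 2 * queriesIn stages U n s v :=
  (groverProtocol d stages).expectedQueriesIn_smul U c n s v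

theorem stepValue_le_verdictFrom (b : Verdict) (s : GroverMem d) (v : Fin d × Fin (0 + 1) → ℂ) :
    (groverProtocol d stages).stepValue U (fun b' => if b' = b then 1 else 0) 0
      (verdictFrom stages U b) s v ≤ verdictFrom stages U b s v :=
  (groverProtocol d stages).stepValue_le_verdictProbFrom U b s v

theorem verdictIn_succ (b : Verdict) (n : ℕ) (s : GroverMem d) (v : Fin d × Fin (0 + 1) → ℂ) :
    verdictIn stages U b (n + 1) s v =
      (groverProtocol d stages).stepValue U (fun b' => if b' = b then 1 else 0) 0
        (verdictIn stages U b n) s v :=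
  congrFun (congrFun ((groverProtocol d stages).verdictProbIn_succ_eq_stepValue U b n) s) v

theorem verdictIn_le_stepValue (b : Verdict) (n : ℕ) (s : GroverMem d)
    (v : Fin d × Fin (0 + 1) → ℂ) : verdictIn stages U b n s v ≤
      (groverProtocol d stages).stepValue U (fun b' => if b' = b then 1 else 0) 0
        (verdictIn stages U b n) s v :=
  (groverProtocol d stages).verdictProbIn_le_stepValue U b n s v

theorem queriesIn_succ (n : ℕ) (s : GroverMem d) (v : Fin d × Fin (0 + 1) → ℂ) :
    queriesIn stages U (n + 1) s v =
      (groverProtocol d stages).stepValue U (fun _ => 0) 1 (queriesIn stages U n) s v :=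
  congrFun (congrFun ((groverProtocol d stages).expectedQueriesIn_succ_eq_stepValue U n) s) v

theorem queriesIn_le_stepValue (n : ℕ) (s : GroverMem d) (v : Fin d × Fin (0 + 1) → ℂ) :
    queriesIn stages U n s v ≤
      (groverProtocol d stages).stepValue U (fun _ => 0) 1 (queriesIn stages U n) s v :=
  (groverProtocol d stages).expectedQueriesIn_le_stepValue U n s v

/-- The probability that a run which starts with stage `J` after the outcome `k` ends with the
verdict `b`. -/
noncomputable def stageVerdictProb (b : Verdict) (k : Fin d) (J : ℕ) : ℝ≥0∞ :=
  verdictFrom stages U b (.attempt k J []) (withWorkspace (basisVec 0))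

/-- The probability of the verdict `b` in the first `n` steps of a run which starts with stage `J`
after the outcome `k`. -/
noncomputable def stageVerdictProbIn (b : Verdict) (n : ℕ) (k : Fin d) (J : ℕ) : ℝ≥0∞ :=
  verdictIn stages U b n (.attempt k J []) (withWorkspace (basisVec 0))

/-- The expected number of queries in the first `n` steps of a run which starts with stage `J`
after the outcome `k`. -/
noncomputable def stageQueriesIn (n : ℕ) (k : Fin d) (J : ℕ) : ℝ≥0∞ :=
  queriesIn stages U n (.attempt k J []) (withWorkspace (basisVec 0))

variable {stages U}

theorem le_stageVerdictProb_coherent {k : Fin d} {J : ℕ} {L : List ℕ} (hL : stages J = some L) :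
    ENNReal.ofReal (1 - missAll (preparedState U) k L) +
      ENNReal.ofReal (missAll (preparedState U) k L) *
        stageVerdictProb stages U .coherent k (J + 1) ≤
          stageVerdictProb stages U .coherent k J := by
  have hF := stepValue_le_verdictFrom stages U .coherent
  have h₁ := rel_attempt isAffinePreorder_ge hF
    (verdictFrom_smul stages U .coherent) k (J + 1) L
  have h₂ := hF (.attempt k J []) (withWorkspace (basisVec 0))
  rw [stepValue_attempt_nil_some k J hL] at h₂
  rw [if_pos rfl, one_mul] at h₁
  exact h₁.trans h₂

theorem le_stageVerdictProb_incoherent {k : Fin d} {J : ℕ} {L : List ℕ}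
    (hL : stages J = some L) :
    ENNReal.ofReal (missAll (preparedState U) k L) *
      stageVerdictProb stages U .incoherent k (J + 1) ≤
        stageVerdictProb stages U .incoherent k J := by
  have hF := stepValue_le_verdictFrom stages U .incoherent
  have h₁ := rel_attempt isAffinePreorder_ge hF
    (verdictFrom_smul stages U .incoherent) k (J + 1) L
  have h₂ := hF (.attempt k J []) (withWorkspace (basisVec 0))
  rw [stepValue_attempt_nil_some k J hL] at h₂
  exact le_add_self.trans (h₁.trans h₂)

theorem one_le_stageVerdictProb_incoherent {k : Fin d} {J : ℕ} (hJ : stages J = none) :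
    1 ≤ stageVerdictProb stages U .incoherent k J := by
  have h := stepValue_le_verdictFrom stages U .incoherent
    (.attempt k J []) (withWorkspace (basisVec 0))
  rw [stepValue_attempt_nil_none k J hJ, if_pos rfl] at h
  exact h

theorem stageVerdictProbIn_succ_le {k : Fin d} {J : ℕ} {L : List ℕ} (hL : stages J = some L)
    (n : ℕ) : stageVerdictProbIn stages U .coherent (n + 1) k J ≤
      ENNReal.ofReal (1 - missAll (preparedState U) k L) +
        ENNReal.ofReal (missAll (preparedState U) k L) *
          stageVerdictProbIn stages U .coherent n k (J + 1) := by
  have h₁ := rel_attempt isAffinePreorder_le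
    (verdictIn_le_stepValue stages U .coherent n)
    (verdictIn_smul stages U .coherent n) k (J + 1) L
  rw [if_pos rfl, one_mul] at h₁
  refine le_trans (le_of_eq ?_) h₁
  rw [stageVerdictProbIn, verdictIn_succ]
  exact stepValue_attempt_nil_some k J hL

theorem stageQueriesIn_succ_le {k : Fin d} {J : ℕ} {L : List ℕ} (hL : stages J = some L)
    (n : ℕ) : stageQueriesIn stages U (n + 1) k J ≤
      cost L + ENNReal.ofReal (missAll (preparedState U) k L) *
        stageQueriesIn stages U n k (J + 1) := by
  have h₁ := attempt_le_cost_add (queriesIn_le_stepValue stages U n)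
    (queriesIn_smul stages U n) k (J + 1) L
  refine le_trans (le_of_eq ?_) h₁
  rw [stageQueriesIn, queriesIn_succ]
  exact stepValue_attempt_nil_some k J hL

theorem stageQueriesIn_eq_zero {k : Fin d} {J : ℕ} (hJ : stages J = none) (n : ℕ) :
    stageQueriesIn stages U n k J = 0 := by
  have h := queriesIn_le_stepValue stages U n (.attempt k J [])
    (withWorkspace (basisVec 0))
  rw [stepValue_attempt_nil_none k J hJ] at h
  exact le_antisymm h zero_le

theorem sum_enorm_sq_preparedState : ∑ o, ‖preparedState U o‖ₑ ^ 2 = 1 := by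
  have : weight (preparedState U) = 1 := by
    rw [weight_eq_ofReal, sqNorm_preparedState, ENNReal.ofReal_one]
  exact this

/-- An average over the first outcome sees only outcomes of nonzero amplitude; for an incoherent
state this leaves the right k alone. -/
theorem sum_enorm_sq_mul_le {f : Fin d → ℝ≥0∞} {B : ℝ≥0∞}
    (h : ∀ k, preparedState U k ≠ 0 → f k ≤ B) : ∑ o, ‖preparedState U o‖ₑ ^ 2 * f o ≤ B := by
  rw [← one_mul B, ← sum_enorm_sq_preparedState (U := U), Finset.sum_mul]
  refine Finset.sum_le_sum fun k _ => ?_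
  rcases eq_or_ne (preparedState U k) 0 with h0 | h0
  · simp [h0]
  · gcongr; exact h k h0

theorem le_sum_enorm_sq_mul {f : Fin d → ℝ≥0∞} {B : ℝ≥0∞}
    (h : ∀ k, preparedState U k ≠ 0 → B ≤ f k) : B ≤ ∑ o, ‖preparedState U o‖ₑ ^ 2 * f o := by
  rw [← one_mul B, ← sum_enorm_sq_preparedState (U := U), Finset.sum_mul]
  refine Finset.sum_le_sum fun k _ => ?_
  rcases eq_or_ne (preparedState U k) 0 with h0 | h0
  · simp [h0]
  · gcongr; exact h k h0

theorem le_verdictProb {b : Verdict} {p : ℝ≥0∞}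
    (h : ∀ k, preparedState U k ≠ 0 → p ≤ stageVerdictProb stages U b k 0) :
    p ≤ (groverProtocol d stages).verdictProb U b := by
  have hF := stepValue_le_verdictFrom stages U b
  have h₁ := hF .start (withWorkspace (basisVec 0))
  rw [stepValue_query false rfl (sqNorm_basisVec 0), zero_add] at h₁
  have h₂ := hF .readout (withWorkspace (preparedState U))
  rw [stepValue_readout (verdictFrom_smul stages U b)] at h₂
  refine (le_sum_enorm_sq_mul h).trans (h₂.trans (h₁.trans (le_of_eq ?_)))
  rw [verdictProb, initial_eq]
  rfl

theorem verdictProb_le {b : Verdict} {p : ℝ≥0∞}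
    (h : ∀ k n, preparedState U k ≠ 0 → stageVerdictProbIn stages U b n k 0 ≤ p) :
    (groverProtocol d stages).verdictProb U b ≤ p := by
  rw [verdictProb, initial_eq]
  refine iSup_le fun n => ?_
  have hF := verdictIn_le_stepValue stages U b n
  have h₁ := hF .start (withWorkspace (basisVec 0))
  rw [stepValue_query false rfl (sqNorm_basisVec 0), zero_add] at h₁
  have h₂ := hF .readout (withWorkspace (preparedState U))
  rw [stepValue_readout (verdictIn_smul stages U b n)] at h₂
  exact h₁.trans (h₂.trans (sum_enorm_sq_mul_le fun k => h k n))

theorem expectedQueries_le {B : ℝ≥0∞}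
    (h : ∀ k n, preparedState U k ≠ 0 → stageQueriesIn stages U n k 0 ≤ B) :
    (groverProtocol d stages).expectedQueries U ≤ 1 + B := by
  rw [expectedQueries, initial_eq]
  refine iSup_le fun n => ?_
  have hF := queriesIn_le_stepValue stages U n
  have h₁ := hF .start (withWorkspace (basisVec 0))
  rw [stepValue_query false rfl (sqNorm_basisVec 0)] at h₁
  have h₂ := hF .readout (withWorkspace (preparedState U))
  rw [stepValue_readout (queriesIn_smul stages U n)] at h₂
  exact h₁.trans (add_le_add le_rfl (h₂.trans (sum_enorm_sq_mul_le fun k => h k n)))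

end Protocol

/-! ### Failure probabilities and costs of attempts -/

/-- The only possible outcome k spans ψ, so the angle is 0 and amplification never produces another
outcome. -/
theorem missAll_eq_one {d : ℕ} {ψ : Fin d → ℂ} (hψ : IsIncoherent ψ) {k : Fin d} (hk : ψ k ≠ 0)
    (L : List ℕ) : missAll ψ k L = 1 := by
  obtain ⟨k', z, hz, rfl⟩ := hψ
  have hkk : k = k' := by
    by_contra h
    simp [basisVec, h] at hk
  subst hkk
  have h : ∀ j, miss (z • basisVec k) k j = 1 := fun j => by
    simp [miss, angle, basisVec, hz]
  induction L with
  | nil => simp [missAll]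
  | cons j L ih => rw [missAll_cons, h, ih, one_mul]

/-- Tripling cannot jump over [π/6, π/2], so the first j with 3^j θ ≥ π/6 lands inside it, where
cos² ≤ 3/4. The query bound follows from √c ≤ sin θ ≤ θ and π/2 ≤ 2. -/
theorem exists_miss_le {d : ℕ} {ψ : Fin d → ℂ} {k : Fin d} {c : ℝ} (hc : 0 < c)
    (hk : c ≤ 1 - ‖ψ k‖ ^ 2) : ∃ j, miss ψ k j ≤ 3 / 4 ∧ (3 : ℝ) ^ j * √c ≤ 2 := by
  set θ := angle ψ k with hθ
  have hsin : √c ≤ θ := by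
    have h1 : Real.sin θ = √(1 - ‖ψ k‖ ^ 2) := Real.sin_arccos _
    have h2 : Real.sin θ ≤ θ := Real.sin_le (Real.arccos_nonneg _)
    exact (Real.sqrt_le_sqrt hk).trans (h1.symm.le.trans h2)
  have hθ0 : 0 < θ := (Real.sqrt_pos.2 hc).trans_le hsin
  have hθ1 : θ ≤ Real.pi / 2 := Real.arccos_le_pi_div_two.2 (norm_nonneg _)
  have hex : ∃ j : ℕ, Real.pi / 6 ≤ 3 ^ j * θ := by
    obtain ⟨j, hj⟩ := pow_unbounded_of_one_lt (Real.pi / 6 / θ) (by norm_num : (1 : ℝ) < 3)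
    exact ⟨j, by rw [← div_le_iff₀ hθ0]; exact hj.le⟩
  classical
  obtain ⟨j, hj, hmin⟩ : ∃ j : ℕ, Real.pi / 6 ≤ 3 ^ j * θ ∧ (3 : ℝ) ^ j * θ ≤ Real.pi / 2 := by
    refine ⟨Nat.find hex, Nat.find_spec hex, ?_⟩
    rcases Nat.eq_zero_or_pos (Nat.find hex) with h0 | h0
    · rw [h0]; simpa using hθ1
    · obtain ⟨i, hi⟩ := Nat.exists_eq_succ_of_ne_zero h0.ne'
      have := Nat.find_min hex (m := i) (by omega)
      rw [hi, pow_succ]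
      push Not at this
      linarith
  refine ⟨j, ?_, ?_⟩
  · have h1 : Real.cos (3 ^ j * θ) ≤ √3 / 2 := by
      rw [← Real.cos_pi_div_six]
      exact Real.cos_le_cos_of_nonneg_of_le_pi (by positivity) (by linarith [Real.pi_pos]) hj
    have h0 : 0 ≤ Real.cos (3 ^ j * θ) :=
      Real.cos_nonneg_of_neg_pi_div_two_le_of_le (by linarith [Real.pi_pos]) hmin
    calc miss ψ k j = Real.cos (3 ^ j * θ) ^ 2 := rfl
      _ ≤ (√3 / 2) ^ 2 := by gcongr
      _ = 3 / 4 := by rw [div_pow, Real.sq_sqrt (by norm_num)]; norm_num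
  · calc (3 : ℝ) ^ j * √c ≤ 3 ^ j * θ := by gcongr
      _ ≤ 2 := by linarith [Real.pi_le_four]

/-- The attempts `0, …, J`, each repeated `r` times. -/
def stageList (r : ℕ) : ℕ → List ℕ
  | 0 => List.replicate r 0
  | J + 1 => stageList r J ++ List.replicate r (J + 1)

theorem cost_append (L L' : List ℕ) : cost (L ++ L') = cost L + cost L' := by simp [cost]

theorem cost_stageList_le (r J : ℕ) : cost (stageList r J) ≤ 2 * r * 3 ^ J := by
  induction J with
  | zero => simp [stageList, cost]; omega
  | succ J ih =>
    rw [stageList, cost_append]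
    have : cost (List.replicate r (J + 1)) = r * 3 ^ (J + 1) := by simp [cost]
    rw [this, pow_succ]
    nlinarith [Nat.zero_le (r * 3 ^ J)]

theorem missAll_append {d : ℕ} (ψ : Fin d → ℂ) (k : Fin d) (L L' : List ℕ) :
    missAll ψ k (L ++ L') = missAll ψ k L * missAll ψ k L' := by simp [missAll]

/-- Only the r copies of the good attempt j are used; every other factor is at most 1. -/
theorem missAll_stageList_le {d : ℕ} {ψ : Fin d → ℂ} {k : Fin d} {j : ℕ}
    (hj : miss ψ k j ≤ 3 / 4) (r : ℕ) {J : ℕ} (hJ : j ≤ J) :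
    missAll ψ k (stageList r J) ≤ (3 / 4) ^ r := by
  have hrep : ∀ i, missAll ψ k (List.replicate r i) = miss ψ k i ^ r := fun i => by simp [missAll]
  have hle : miss ψ k j ^ r ≤ (3 / 4) ^ r := pow_le_pow_left₀ (miss_nonneg _ _ _) hj r
  induction J with
  | zero =>
    obtain rfl : j = 0 := by omega
    rw [stageList, hrep]; exact hle
  | succ J ih =>
    rw [stageList, missAll_append]
    rcases hJ.lt_or_eq with h | h
    · calc _ ≤ missAll ψ k (stageList r J) * 1 :=
            mul_le_mul_of_nonneg_left (missAll_le_one _ _ _) (missAll_nonneg _ _ _)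
        _ ≤ _ := by rw [mul_one]; exact ih (by omega)
    · subst h
      calc _ ≤ 1 * missAll ψ k (List.replicate r (J + 1)) :=
            mul_le_mul_of_nonneg_right (missAll_le_one _ _ _) (missAll_nonneg _ _ _)
        _ ≤ _ := by rw [one_mul, hrep]; exact hle

end GroverProtocol

/-! ### Endless and single-stage searches -/

namespace GroverProtocol

open Protocol

variable {d : ℕ} [NeZero d] {U : Matrix.unitaryGroup (Fin d) ℂ}

/-- Take r = ⌈8 log δ⁻¹⌉; as 3/4 ≤ exp(-1/4), the power is at most δ² ≤ 1/4. The bound 1/4 beats the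
tripling of costs between stages, and 1 ≤ 2 log δ⁻¹ absorbs rounding and the first query. -/
theorem exists_repetitions {δ : ℝ} (hδ0 : 0 < δ) (hδ : δ < 1 / 2) :
    ∃ r : ℕ, (3 / 4 : ℝ) ^ r ≤ δ ∧ (3 / 4 : ℝ) ^ r ≤ 1 / 4 ∧ (r : ℝ) ≤ 10 * Real.log δ⁻¹ ∧
      1 ≤ 2 * Real.log δ⁻¹ := by
  set L := Real.log δ⁻¹ with hL
  have hL2 : 1 ≤ 2 * L := by
    have h1 : Real.log 2 ≤ L := Real.log_le_log (by norm_num) (by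
      rw [le_inv_comm₀ (by norm_num) hδ0]; linarith)
    linarith [Real.log_two_gt_d9]
  have hexp : Real.exp (-L) = δ := by rw [hL, Real.log_inv, neg_neg, Real.exp_log hδ0]
  have hr : (3 / 4 : ℝ) ^ ⌈8 * L⌉₊ ≤ δ ^ 2 := by
    calc (3 / 4 : ℝ) ^ ⌈8 * L⌉₊ ≤ Real.exp (-(1 / 4)) ^ ⌈8 * L⌉₊ := by
          gcongr
          linarith [Real.add_one_le_exp (-(1 / 4) : ℝ)]
      _ = Real.exp (⌈8 * L⌉₊ * (-(1 / 4))) := by rw [Real.exp_nat_mul]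
      _ ≤ Real.exp (2 * (-L)) := by
          apply Real.exp_le_exp.2
          linarith [Nat.le_ceil (8 * L)]
      _ = δ ^ 2 := by rw [← hexp, ← Real.exp_nat_mul]; norm_num
  refine ⟨⌈8 * L⌉₊, hr.trans (by nlinarith), hr.trans (by nlinarith), ?_, hL2⟩
  have := Nat.ceil_lt_add_one (by linarith : 0 ≤ 8 * L)
  linarith

section Unbounded

variable {r : ℕ}

/-- The stages of a search that never gives up. -/
def endlessStages (r J : ℕ) : Option (List ℕ) := some (stageList r J)

theorem ofReal_cost_stageList_le (r J : ℕ) :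
    (cost (stageList r J) : ℝ≥0∞) ≤ ENNReal.ofReal (2 * r * 3 ^ J) := by
  have h : ((2 * r * 3 ^ J : ℕ) : ℝ) = 2 * r * 3 ^ J := by push_cast; ring
  rw [← h, ENNReal.ofReal_natCast]
  exact_mod_cast cost_stageList_le r J

theorem verdictProb_coherent_eq_zero (hU : IsIncoherent (preparedState U)) :
    (groverProtocol d (endlessStages r)).verdictProb U .coherent = 0 := by
  refine le_antisymm (verdictProb_le fun k n hk => ?_) zero_le
  suffices ∀ J, stageVerdictProbIn (endlessStages r) U .coherent n k J ≤ 0 from this 0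
  induction n with
  | zero => intro J; exact le_rfl
  | succ n ih =>
    intro J
    refine (stageVerdictProbIn_succ_le rfl n).trans ?_
    rw [missAll_eq_one hU hk, sub_self, ENNReal.ofReal_zero, zero_add, ENNReal.ofReal_one,
      one_mul]
    exact ih (J + 1)

variable {k : Fin d} {j : ℕ} {δ : ℝ}

/-- A stage J ≥ j succeeds often enough by itself. An earlier stage either succeeds or hands over to
the next one, so the bound propagates downwards. -/
theorem le_stageVerdictProb_endless (hj : miss (preparedState U) k j ≤ 3 / 4) (hδ0 : 0 < δ)
    (hr : (3 / 4 : ℝ) ^ r ≤ δ) (J : ℕ) :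
    ENNReal.ofReal (1 - δ) ≤ stageVerdictProb (endlessStages r) U .coherent k J := by
  have hle : ∀ J, j ≤ J →
      ENNReal.ofReal (1 - δ) ≤ stageVerdictProb (endlessStages r) U .coherent k J := fun J hJ =>
    (ENNReal.ofReal_le_ofReal (sub_le_sub_left ((missAll_stageList_le hj r hJ).trans hr) 1)).trans
      (le_self_add.trans (le_stageVerdictProb_coherent rfl))
  rcases le_total j J with hJ | hJ
  · exact hle J hJ
  · induction hJ using Nat.decreasingInduction with
    | self => exact hle j le_rfl
    | of_succ J hJ ih =>
      refine le_trans ?_ (le_stageVerdictProb_coherent rfl)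
      set M := missAll (preparedState U) k (stageList r J) with hM
      have hM0 : 0 ≤ M := missAll_nonneg _ _ _
      have hM1 : M ≤ 1 := missAll_le_one _ _ _
      calc ENNReal.ofReal (1 - δ) ≤
            ENNReal.ofReal (1 - M) + ENNReal.ofReal M * ENNReal.ofReal (1 - δ) := by
            rw [← ENNReal.ofReal_mul hM0]
            refine le_trans (ENNReal.ofReal_le_ofReal ?_) ENNReal.ofReal_add_le
            nlinarith
        _ ≤ _ := by gcongr

/-- The constant 8 solves the recursion: 2 · 3^J + (1/4) · 8 · 3^(J+1) = 8 · 3^J. -/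
theorem stageQueriesIn_le_of_le (hj : miss (preparedState U) k j ≤ 3 / 4)
    (hr : (3 / 4 : ℝ) ^ r ≤ 1 / 4) (n : ℕ) {J : ℕ} (hJ : j ≤ J) :
    stageQueriesIn (endlessStages r) U n k J ≤ ENNReal.ofReal (8 * r * 3 ^ J) := by
  induction n generalizing J with
  | zero => exact zero_le
  | succ n ih =>
    refine (stageQueriesIn_succ_le rfl n).trans ?_
    have h := (missAll_stageList_le hj r hJ).trans hr
    calc _ ≤ ENNReal.ofReal (2 * r * 3 ^ J) +
          ENNReal.ofReal (1 / 4) * ENNReal.ofReal (8 * r * 3 ^ (J + 1)) := by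
          gcongr
          · exact ofReal_cost_stageList_le r J
          · exact ih (hJ.trans (Nat.le_succ J))
      _ = ENNReal.ofReal (8 * r * 3 ^ J) := by
          rw [← ENNReal.ofReal_mul (by norm_num), ← ENNReal.ofReal_add (by positivity)
            (by positivity)]
          congr 1
          ring

/-- Before stage j nothing is known about success and the costs simply add up. The form telescopes,
since 2 · 3^J = 3^(J+1) − 3^J, and matches 8 r 3^j at J = j. -/
theorem stageQueriesIn_le (hj : miss (preparedState U) k j ≤ 3 / 4)
    (hr : (3 / 4 : ℝ) ^ r ≤ 1 / 4) (n : ℕ) {J : ℕ} (hJ : J ≤ j) :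
    stageQueriesIn (endlessStages r) U n k J ≤ ENNReal.ofReal (r * (9 * 3 ^ j - 3 ^ J)) := by
  induction n generalizing J with
  | zero => exact zero_le
  | succ n ih =>
    rcases hJ.eq_or_lt with rfl | hlt
    · refine (stageQueriesIn_le_of_le hj hr (n + 1) le_rfl).trans (le_of_eq ?_)
      congr 1
      ring
    · refine (stageQueriesIn_succ_le rfl n).trans ?_
      have h := missAll_le_one (preparedState U) k (stageList r J)
      have h3 : (3 : ℝ) ^ (J + 1) ≤ 3 ^ j := pow_le_pow_right₀ (by norm_num) hlt
      have h0 : (0 : ℝ) ≤ 9 * 3 ^ j - 3 ^ (J + 1) := by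
        have : (0 : ℝ) < 3 ^ j := by positivity
        linarith
      calc _ ≤ ENNReal.ofReal (2 * r * 3 ^ J) +
            ENNReal.ofReal 1 * ENNReal.ofReal (r * (9 * 3 ^ j - 3 ^ (J + 1))) := by
            gcongr
            · exact ofReal_cost_stageList_le r J
            · exact ih hlt
        _ = ENNReal.ofReal (r * (9 * 3 ^ j - 3 ^ J)) := by
            rw [ENNReal.ofReal_one, one_mul, ← ENNReal.ofReal_add (by positivity) (by positivity)]
            congr 1
            ring

theorem endless_expectedQueries_le (hr : (3 / 4 : ℝ) ^ r ≤ 1 / 4)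
    (hU : ¬ IsIncoherent (preparedState U)) :
    (groverProtocol d (endlessStages r)).expectedQueries U ≤
      1 + ENNReal.ofReal (18 * r / √(geometricCoherence (preparedState U))) := by
  have hc := geometricCoherence_pos (sqNorm_preparedState U) hU
  refine expectedQueries_le fun k n _ => ?_
  obtain ⟨j, hj, hj2⟩ := exists_miss_le hc (geometricCoherence_le (preparedState U) k)
  refine (stageQueriesIn_le hj hr n (Nat.zero_le j)).trans (ENNReal.ofReal_le_ofReal ?_)
  rw [le_div_iff₀ (Real.sqrt_pos.2 hc)]
  have h0 : (0 : ℝ) ≤ r := Nat.cast_nonneg r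
  have h1 := Real.sqrt_nonneg (geometricCoherence (preparedState U))
  calc _ ≤ (r : ℝ) * (9 * 3 ^ j) * √(geometricCoherence (preparedState U)) := by
        gcongr; simp
    _ = r * 9 * (3 ^ j * √(geometricCoherence (preparedState U))) := by ring
    _ ≤ r * 9 * 2 := by gcongr
    _ = _ := by ring

theorem endless_le_verdictProb (hδ0 : 0 < δ) (hr : (3 / 4 : ℝ) ^ r ≤ δ)
    (hU : ¬ IsIncoherent (preparedState U)) :
    ENNReal.ofReal (1 - δ) ≤ (groverProtocol d (endlessStages r)).verdictProb U .coherent := by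
  have hc := geometricCoherence_pos (sqNorm_preparedState U) hU
  refine le_verdictProb fun k _ => ?_
  obtain ⟨j, hj, -⟩ := exists_miss_le hc (geometricCoherence_le (preparedState U) k)
  exact le_stageVerdictProb_endless hj hδ0 hr 0

end Unbounded

section Bounded

/-- A single stage, after which the search gives up. -/
def singleStage (r J : ℕ) : ℕ → Option (List ℕ)
  | 0 => some (stageList r J)
  | _ + 1 => none

theorem singleStage_expectedQueries_le (r J : ℕ) :
    (groverProtocol d (singleStage r J)).expectedQueries U ≤
      1 + ENNReal.ofReal (2 * r * 3 ^ J) := by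
  refine expectedQueries_le fun k n _ => ?_
  cases n with
  | zero => exact zero_le
  | succ n =>
    refine (stageQueriesIn_succ_le rfl n).trans ?_
    rw [stageQueriesIn_eq_zero rfl, mul_zero, add_zero]
    exact ofReal_cost_stageList_le r J

theorem singleStage_testsCoherence {r J : ℕ} {δ ε : ℝ} (hδ0 : 0 < δ) (hε : 0 < ε)
    (hr : (3 / 4 : ℝ) ^ r ≤ δ) (hJ : 2 / √ε ≤ 3 ^ J) :
    (groverProtocol d (singleStage r J)).TestsCoherence ε δ := by
  constructor
  · intro U hU
    refine le_verdictProb fun k hk => ?_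
    refine le_trans ?_ (le_stageVerdictProb_incoherent rfl)
    rw [missAll_eq_one hU hk, ENNReal.ofReal_one, one_mul]
    refine le_trans ?_ (one_le_stageVerdictProb_incoherent rfl)
    rw [ENNReal.ofReal_le_one]
    linarith
  · intro U hU
    refine le_verdictProb fun k _ => ?_
    obtain ⟨j, hj, hj2⟩ := exists_miss_le hε (hU.trans (geometricCoherence_le (preparedState U) k))
    have hjJ : j ≤ J := by
      rw [← le_div_iff₀ (Real.sqrt_pos.2 hε)] at hj2
      exact (pow_le_pow_iff_right₀ (by norm_num : (1 : ℝ) < 3)).1 (hj2.trans hJ)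
    refine le_trans ?_ (le_stageVerdictProb_coherent rfl)
    exact (ENNReal.ofReal_le_ofReal (sub_le_sub_left
      ((missAll_stageList_le hj r hjJ).trans hr) 1)).trans le_self_add

end Bounded

end GroverProtocol

/-! ### Large thresholds and the final constants -/

/-- The protocol that reports "incoherent" at once. -/
def trivialProtocol (d : ℕ) : Protocol d where
  work := 0
  Mem := Unit
  start := ()
  action _ := .halt .incoherent

theorem trivialProtocol_expectedQueries {d : ℕ} [NeZero d] (U : Matrix.unitaryGroup (Fin d) ℂ) :
    (trivialProtocol d).expectedQueries U = 0 := by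
  refine le_antisymm (iSup_le fun n => ?_) zero_le
  cases n <;> exact le_rfl

/-- No state has coherence 1 or more, so the second requirement is vacuous. Large ε needs this
query-free test, because ε^(-1/2) log δ⁻¹ may fall below the cost of a single query. -/
theorem trivialProtocol_testsCoherence {d : ℕ} [NeZero d] {ε δ : ℝ} (hε : 1 ≤ ε) (hδ : 0 < δ) :
    (trivialProtocol d).TestsCoherence ε δ := by
  constructor
  · intro U _
    refine le_trans ?_
      (le_iSup (fun n => (trivialProtocol d).verdictProbIn U .incoherent n _ _) 1)
    have h : (trivialProtocol d).verdictProbIn U .incoherent 1 (trivialProtocol d).start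
        (trivialProtocol d).initial = weight (trivialProtocol d).initial := rfl
    rw [h, Protocol.weight_initial, ENNReal.ofReal_le_one]
    linarith
  · intro U hU
    have := geometricCoherence_lt_one (sqNorm_preparedState U)
    linarith

theorem theorem2 :
    -- Upper bound: a protocol that does not know `ψ` or `c(ψ)` and never raises a false alarm.
    (∃ K : ℝ, 0 < K ∧ ∀ (d : ℕ) [NeZero d] (δ : ℝ), 0 < δ → δ < 1 / 2 →
      ∃ P : Protocol d,
        (∀ U, IsIncoherent (preparedState U) → P.verdictProb U .coherent = 0) ∧
        (∀ U, ¬ IsIncoherent (preparedState U) →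
          ENNReal.ofReal (1 - δ) ≤ P.verdictProb U .coherent ∧
          P.expectedQueries U ≤
            ENNReal.ofReal (K * (Real.log δ⁻¹ / √(geometricCoherence (preparedState U)))))) ∧
    -- Lower bound at fixed `δ`, for each individual coherent state.
    (∀ δ : ℝ, 0 < δ → δ < 1 / 2 → ∃ K : ℝ, 0 < K ∧ ∀ (d : ℕ) [NeZero d] (P : Protocol d),
      (∀ U, IsIncoherent (preparedState U) →
        P.verdictProb U .coherent ≤ ENNReal.ofReal δ) →
      ∀ U, ¬ IsIncoherent (preparedState U) →
        ENNReal.ofReal (1 - δ) ≤ P.verdictProb U .coherent →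
        ENNReal.ofReal (K * (Real.log δ⁻¹ / √(geometricCoherence (preparedState U)))) ≤
          P.expectedQueries U) ∧
    -- Upper bound for deciding between incoherence and coherence at least `ε`.
    (∃ K : ℝ, 0 < K ∧ ∀ (d : ℕ) [NeZero d] (δ ε : ℝ), 0 < δ → δ < 1 / 2 → 0 < ε →
      ∃ P : Protocol d, P.TestsCoherence ε δ ∧
        ∀ U, P.expectedQueries U ≤ ENNReal.ofReal (K * (Real.log δ⁻¹ / √ε))) ∧
    -- Matching lower bound, uniform in `δ`.
    (∀ δ₀ τ : ℝ, δ₀ < 1 / 2 → τ < 1 → ∃ K : ℝ, 0 < K ∧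
      ∀ (d : ℕ) [NeZero d] (δ ε : ℝ), 0 < δ → δ ≤ δ₀ → 0 < ε → ε ≤ τ * (1 - 1 / (d : ℝ)) →
      ∀ P : Protocol d, P.TestsCoherence ε δ →
        ∃ U, (IsIncoherent (preparedState U) ∨ ε ≤ geometricCoherence (preparedState U)) ∧
          ENNReal.ofReal (K * (Real.log δ⁻¹ / √ε)) ≤ P.expectedQueries U) := by
  refine ⟨⟨200, by norm_num, fun d _ δ hδ0 hδ => ?_⟩, fun δ hδ0 hδ => ?_,
    ⟨200, by norm_num, fun d _ δ ε hδ0 hδ hε => ?_⟩, fun δ₀ τ hδ₀ hτ => ?_⟩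
  · obtain ⟨r, hr, hr4, hrL, hL⟩ := GroverProtocol.exists_repetitions hδ0 hδ
    refine ⟨groverProtocol d (GroverProtocol.endlessStages r),
      fun U hU => GroverProtocol.verdictProb_coherent_eq_zero hU, fun U hU =>
      ⟨GroverProtocol.endless_le_verdictProb hδ0 hr hU,
        (GroverProtocol.endless_expectedQueries_le hr4 hU).trans ?_⟩⟩
    set c := geometricCoherence (preparedState U) with hc
    have hc0 : 0 < √c := Real.sqrt_pos.2 (geometricCoherence_pos (sqNorm_preparedState U) hU)
    have hc1 : √c ≤ 1 :=
      Real.sqrt_le_one.2 (geometricCoherence_lt_one (sqNorm_preparedState U)).le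
    rw [← ENNReal.ofReal_one, ← ENNReal.ofReal_add zero_le_one (by positivity)]
    refine ENNReal.ofReal_le_ofReal ?_
    -- It remains to see √c + 18 r ≤ 200 log δ⁻¹, and the left side is at most (2 + 180) log δ⁻¹.
    rw [mul_div_assoc', le_div_iff₀ hc0, add_mul, div_mul_cancel₀ _ hc0.ne']
    linarith
  · have hL : 0 < Real.log δ⁻¹ := Real.log_pos ((one_lt_inv₀ hδ0).2 (by linarith))
    have hκ : 0 < √(1 / 2) - √δ := sub_pos.2 (Real.sqrt_lt_sqrt hδ0.le hδ)
    have hδ2 : 0 < 1 - 2 * δ := by linarith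
    -- The hybrid bound carries no logarithm; at fixed δ the constant absorbs it.
    refine ⟨(√(1 / 2) - √δ) * (1 - 2 * δ) / 16 / Real.log δ⁻¹, by positivity,
      fun d _ P hP U hU hUc => ?_⟩
    convert P.ofReal_le_expectedQueries_of_detects hδ0 hδ hP U hU hUc using 2
    have hL0 := hL.ne'
    generalize Real.log δ⁻¹ = L at hL0
    field_simp
  · obtain ⟨r, hr, -, hrL, hL⟩ := GroverProtocol.exists_repetitions hδ0 hδ
    rcases le_or_gt 1 ε with hε1 | hε1
    · exact ⟨trivialProtocol d, trivialProtocol_testsCoherence hε1 hδ0, fun U => by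
        rw [trivialProtocol_expectedQueries]; exact zero_le⟩
    · have hs0 : 0 < √ε := Real.sqrt_pos.2 hε
      have hs1 : √ε ≤ 1 := Real.sqrt_le_one.2 hε1.le
      -- Here 3^J ≤ 2/√ε < 3^(J+1), so the stage with attempts up to J + 1 is deep enough and
      -- overshoots by a factor of at most 3.
      obtain ⟨J, hJ1, hJ2⟩ := exists_nat_pow_near (x := 2 / √ε) (y := 3)
        (by rw [le_div_iff₀ hs0]; linarith) (by norm_num)
      refine ⟨groverProtocol d (GroverProtocol.singleStage r (J + 1)),
        GroverProtocol.singleStage_testsCoherence hδ0 hε hr hJ2.le, fun U =>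
          (GroverProtocol.singleStage_expectedQueries_le r (J + 1)).trans ?_⟩
      rw [← ENNReal.ofReal_one, ← ENNReal.ofReal_add zero_le_one (by positivity)]
      refine ENNReal.ofReal_le_ofReal ?_
      rw [le_div_iff₀ hs0] at hJ1
      rw [mul_div_assoc', le_div_iff₀ hs0, pow_succ]
      have h0 : (0 : ℝ) ≤ r := Nat.cast_nonneg r
      calc (1 + 2 * r * (3 ^ J * 3)) * √ε = √ε + 6 * r * (3 ^ J * √ε) := by ring
        _ ≤ 1 + 6 * r * 2 := by gcongr
        _ ≤ _ := by linarith
  · rcases le_or_gt δ₀ 0 with h0 | h0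
    · exact ⟨1, one_pos, fun d _ δ ε hδ0 hδ => absurd (hδ0.trans_le hδ) h0.not_gt⟩
    · have hlog2 : Real.log 2 < Real.log δ₀⁻¹ := Real.log_lt_log (by norm_num) (by
        rw [lt_inv_comm₀ (by norm_num) h0]; linarith)
      have hlog : 0 < Real.log δ₀⁻¹ := (Real.log_pos (by norm_num)).trans hlog2
      have h1 : 0 < 1 - Real.log 2 / Real.log δ₀⁻¹ := sub_pos.2 ((div_lt_one hlog).2 hlog2)
      have h2 : 0 < 1 - 2 * δ₀ := by linarith
      have h3 : 0 < √(1 - τ) := Real.sqrt_pos.2 (by linarith)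
      exact ⟨(1 - 2 * δ₀) / 8 * (1 - Real.log 2 / Real.log δ₀⁻¹) * √(1 - τ), by positivity,
        fun d _ δ ε hδ0 hδ hε hετ P hP => ⟨1, Or.inl Protocol.isIncoherent_preparedState_one,
          hP.ofReal_le_expectedQueries hδ0 hδ hδ₀ hτ hε hετ⟩⟩
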